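/- Let $\mathbb D$ and $\mathbb T$ be the open unit disc and the unit circle in $\mathbb C$. Let $H^2(\mathbb D^2)$ be the Hilbert space of holomorphic functions $f$ on $\mathbb D^2$ with $\sup_{0\le t<1}\int_{\mathbb T^2}|f(t\zeta)|^2\,dm(\zeta)<\infty$, where $m$ is normalized Lebesgue measure on $\mathbb T^2$, with inner product $\langle f,g\rangle=\lim_{t\to1^-}\int_{\mathbb T^2}f(t\zeta)\overline{g(t\zeta)}\,dm(\zeta)$. Let $M_1,M_2$ be the operators of multiplication by the coordinates $z,w$ on $H^2(\mathbb D^2)$. A quotient module is a closed subspace $\mathfrak Q\subseteq H^2(\mathbb D^2)$ with $M_i^*\mathfrak Q\subseteq\mathfrak Q$ for $i=1,2$. With $P_{\mathfrak Q}$ the orthogonal projection onto $\mathfrak Q$ and $Q_i=P_{\mathfrak Q}M_i|_{\mathfrak Q}$, it is called $\varphi$-doubly commuting if $Q_1Q_2Q_2^*=Q_2^*Q_1Q_2$ on $\mathfrak Q$. An inner function on $\mathbb D$ is a bounded holomorphic function on $\mathbb D$ whose radial limits exist and have modulus one at almost every point of $\mathbb T$. **Theorem.** Let $\theta_1$ and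 $\theta_2$ be inner functions on $\mathbb D$ such that $\theta_1(a)=\theta_2(b)=0$ for some $a,b\in\mathbb D$. Then the quotient module $$\mathfrak Q=H^2(\mathbb D^2)\ominus\theta_1(z)\theta_2(w)H^2(\mathbb D^2)$$ is $\varphi$-doubly commuting if and only if there are $c_1,c_2\in\mathbb T$ such that $\theta_1(z)=c_1z$ and $\theta_2(w)=c_2w$ for all $z,w\in\mathbb D$. -/

import Mathlib

noncomputable section

namespace BidiscHardy

open Set Filter Topology MeasureTheory
open scoped ComplexConjugate ENNReal

/-- The open unit bidisc. -/
def bidisc : Set (ℂ × ℂ) := Metric.ball 0 1 ×ˢ Metric.ball 0 1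

/-- The normalized Lebesgue (Haar) measure on the torus, which is parametrized by `(ℝ / ℤ)²`. -/
def torusMeasure : Measure (UnitAddTorus (Fin 2)) :=
  Measure.pi fun _ => AddCircle.haarAddCircle

/-- The point `(s e^{2π i x₀}, t e^{2π i x₁})` of the torus of radii `s, t`. -/
def torusPoint (s t : ℝ) (x : UnitAddTorus (Fin 2)) : ℂ × ℂ :=
  ((s : ℂ) * (AddCircle.toCircle (x 0) : ℂ), (t : ℂ) * (AddCircle.toCircle (x 1) : ℂ))

instance : IsProbabilityMeasure torusMeasure := by unfold torusMeasure; infer_instance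

lemma continuous_torusPoint (s t : ℝ) : Continuous (torusPoint s t) := by
  unfold torusPoint
  have h : Continuous (fun x : UnitAddCircle => (AddCircle.toCircle x : ℂ)) :=
    continuous_induced_dom.comp AddCircle.continuous_toCircle
  exact (continuous_const.mul (h.comp (continuous_apply 0))).prodMk
    (continuous_const.mul (h.comp (continuous_apply 1)))

lemma norm_mul_toCircle_lt {s : ℝ} (hs : s ∈ Ico (0 : ℝ) 1) (x : UnitAddCircle) :
    (s : ℂ) * (AddCircle.toCircle x : ℂ) ∈ Metric.ball (0 : ℂ) 1 := by
  simp [abs_of_nonneg hs.1, hs.2, Circle.norm_coe]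

lemma torusPoint_mem {s t : ℝ} (hs : s ∈ Ico (0 : ℝ) 1) (ht : t ∈ Ico (0 : ℝ) 1)
    (x : UnitAddTorus (Fin 2)) : torusPoint s t x ∈ bidisc :=
  ⟨norm_mul_toCircle_lt hs _, norm_mul_toCircle_lt ht _⟩

lemma continuous_slice {f : ℂ × ℂ → ℂ} (hf : DifferentiableOn ℂ f bidisc) {s t : ℝ}
    (hs : s ∈ Ico (0 : ℝ) 1) (ht : t ∈ Ico (0 : ℝ) 1) :
    Continuous fun x => f (torusPoint s t x) :=
  hf.continuousOn.comp_continuous (continuous_torusPoint s t) (torusPoint_mem hs ht)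

/-- Fourier coefficients of the restriction of `f` to the torus of radii `s, t`. -/
def torusCoeff (f : ℂ × ℂ → ℂ) (s t : ℝ) (k : Fin 2 → ℤ) : ℂ :=
  ∫ x, UnitAddTorus.mFourier (-k) x * f (torusPoint s t x) ∂torusMeasure

lemma integral_conj_mul_hasSum {F G : UnitAddTorus (Fin 2) → ℂ} (hF : Continuous F)
    (hG : Continuous G) :
    HasSum (fun k : Fin 2 → ℤ =>
      conj (∫ x, UnitAddTorus.mFourier (-k) x * F x ∂torusMeasure) *
        ∫ x, UnitAddTorus.mFourier (-k) x * G x ∂torusMeasure)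
      (∫ x, conj (F x) * G x ∂torusMeasure) := by
  have h := UnitAddTorus.hasSum_prod_mFourierCoeff
    (ContinuousMap.toLp (E := ℂ) 2 torusMeasure ℂ ⟨F, hF⟩)
    (ContinuousMap.toLp (E := ℂ) 2 torusMeasure ℂ ⟨G, hG⟩)
  have e : ∀ (H : C(UnitAddTorus (Fin 2), ℂ)) (k : Fin 2 → ℤ),
      UnitAddTorus.mFourierCoeff (ContinuousMap.toLp (E := ℂ) 2 torusMeasure ℂ H) k
        = ∫ x, UnitAddTorus.mFourier (-k) x * H x ∂torusMeasure := fun H k =>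
    UnitAddTorus.mFourierCoeff_toLp H k
  convert h using 1
  · ext k
    exact congrArg₂ (fun u v : ℂ => conj u * v) (e ⟨F, hF⟩ k).symm (e ⟨G, hG⟩ k).symm
  apply integral_congr_ae
  filter_upwards [ContinuousMap.coeFn_toLp (E := ℂ) (p := 2) (𝕜 := ℂ) torusMeasure ⟨F, hF⟩,
    ContinuousMap.coeFn_toLp (E := ℂ) (p := 2) (𝕜 := ℂ) torusMeasure ⟨G, hG⟩] with x h1 h2
  erw [h1, h2]
  rfl

lemma integral_mFourier (k j : Fin 2 → ℤ) :
    ∫ x, UnitAddTorus.mFourier (-k) x * UnitAddTorus.mFourier j x ∂torusMeasure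
      = if k = j then 1 else 0 := by
  have h := orthonormal_iff_ite.mp (UnitAddTorus.orthonormal_mFourier (d := Fin 2)) k j
  rw [← h, ContinuousMap.inner_toLp]
  refine integral_congr_ae (ae_of_all _ fun x => ?_)
  simp only [UnitAddTorus.mFourier_neg]
  exact mul_comm _ _

lemma integral_fourier (k j : ℤ) :
    ∫ x : UnitAddCircle, fourier (-k) x * fourier j x ∂AddCircle.haarAddCircle
      = if k = j then 1 else 0 := by
  have h := orthonormal_iff_ite.mp (orthonormal_fourier (T := (1 : ℝ))) k j
  rw [← h, ContinuousMap.inner_toLp]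
  refine integral_congr_ae (ae_of_all _ fun x => ?_)
  simp only [fourier_neg]
  exact mul_comm _ _

/-- Fourier coefficients of a holomorphic function of one variable on circles. -/
lemma exists_disc_coeff {g : ℂ → ℂ} (hg : DifferentiableOn ℂ g (Metric.ball 0 1)) (k : ℤ) :
    ∃ b : ℂ, (k < 0 → b = 0) ∧ ∀ s ∈ Ico (0 : ℝ) 1,
      ∫ x : UnitAddCircle, fourier (-k) x * g ((s : ℂ) * (AddCircle.toCircle x : ℂ))
        ∂AddCircle.haarAddCircle = b * (s : ℂ) ^ k.toNat := by
  classical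
  refine ⟨if k < 0 then 0 else (k.toNat.factorial : ℂ)⁻¹ * iteratedDeriv k.toNat g 0,
    fun h => if_pos h, fun s hs => ?_⟩
  set b : ℕ → ℂ := fun n => (n.factorial : ℂ)⁻¹ * iteratedDeriv n g 0 with hb
  have hT : ∀ z ∈ Metric.ball (0 : ℂ) 1, HasSum (fun n => b n * z ^ n) (g z) := by
    intro z hz
    have := Complex.hasSum_taylorSeries_on_ball (c := 0) (r := 1) (f := g) (by simpa using hg)
      (z := z) (by simpa using hz)
    have e : (fun n => b n * z ^ n) =
        fun n : ℕ => (n.factorial : ℂ)⁻¹ • (z - 0) ^ n • iteratedDeriv n g 0 := by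
      ext n
      simp only [hb, sub_zero, smul_eq_mul]
      ring
    rwa [e]
  have hsum : Summable fun n => ‖b n‖ * s ^ n := by
    have := (hT s (by simp [abs_of_nonneg hs.1, hs.2])).summable.norm
    simpa [abs_of_nonneg hs.1] using this
  have e : ∀ x : UnitAddCircle, fourier (-k) x * g ((s : ℂ) * (AddCircle.toCircle x : ℂ))
      = ∑' n : ℕ, (b n * (s : ℂ) ^ n) * (fourier (-k) x * fourier (n : ℤ) x) := by
    intro x
    rw [← (hT _ (norm_mul_toCircle_lt hs x)).tsum_eq, ← tsum_mul_left]
    congr 1; ext n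
    have : fourier (n : ℤ) x = (AddCircle.toCircle x : ℂ) ^ n := by
      simp [fourier_apply, AddCircle.toCircle_nsmul]
    rw [this]; ring
  simp_rw [e]
  have hc : ∀ n : ℕ, Continuous fun x : UnitAddCircle =>
      (b n * (s : ℂ) ^ n) * (fourier (-k) x * fourier (n : ℤ) x) := fun n => by fun_prop
  rw [← integral_tsum_of_summable_integral_norm
    (fun n => (hc n).integrable_of_hasCompactSupport (HasCompactSupport.of_compactSpace _))]
  · simp_rw [integral_const_mul, integral_fourier]
    split_ifs with hk
    · rw [zero_mul]
      convert tsum_zero with n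
      rw [if_neg (by omega), mul_zero]
    · rw [tsum_eq_single k.toNat]
      · rw [if_pos (by omega), mul_one]
      · intro n hn
        rw [if_neg (by omega), mul_zero]
  · convert hsum using 2 with n
    simp [abs_of_nonneg hs.1, fourier_apply, Circle.norm_coe]


lemma torusCoeff_iterated (f : ℂ × ℂ → ℂ) (s t : ℝ) (k : Fin 2 → ℤ) :
    torusCoeff f s t k = ∫ x : UnitAddCircle × UnitAddCircle,
      fourier (-k 0) x.1 * (fourier (-k 1) x.2 *
      f ((s : ℂ) * (AddCircle.toCircle x.1 : ℂ), (t : ℂ) * (AddCircle.toCircle x.2 : ℂ)))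
       ∂(AddCircle.haarAddCircle.prod AddCircle.haarAddCircle) := by
  have h := measurePreserving_finTwoArrow (AddCircle.haarAddCircle (T := (1 : ℝ)))
  rw [← h.integral_comp (MeasurableEquiv.measurableEmbedding _)]
  unfold torusCoeff torusMeasure
  refine integral_congr_ae (ae_of_all _ fun x => ?_)
  simp [UnitAddTorus.mFourier, torusPoint, mul_assoc]

lemma continuous_toCircle_coe : Continuous (fun x : UnitAddCircle => (AddCircle.toCircle x : ℂ)) :=
  continuous_induced_dom.comp AddCircle.continuous_toCircle

lemma integrable_iterated {f : ℂ × ℂ → ℂ} (hf : DifferentiableOn ℂ f bidisc) {s t : ℝ}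
    (hs : s ∈ Ico (0 : ℝ) 1) (ht : t ∈ Ico (0 : ℝ) 1) (k : Fin 2 → ℤ) :
    Integrable (fun x : UnitAddCircle × UnitAddCircle =>
      fourier (-k 0) x.1 * (fourier (-k 1) x.2 *
      f ((s : ℂ) * (AddCircle.toCircle x.1 : ℂ), (t : ℂ) * (AddCircle.toCircle x.2 : ℂ))))
       (AddCircle.haarAddCircle.prod AddCircle.haarAddCircle) := by
  refine Continuous.integrable_of_hasCompactSupport ?_ (HasCompactSupport.of_compactSpace _)
  have h1 : Continuous fun x : UnitAddCircle × UnitAddCircle =>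
      f ((s : ℂ) * (AddCircle.toCircle x.1 : ℂ), (t : ℂ) * (AddCircle.toCircle x.2 : ℂ)) := by
    refine hf.continuousOn.comp_continuous ?_ fun x =>
      ⟨norm_mul_toCircle_lt hs _, norm_mul_toCircle_lt ht _⟩
    exact (continuous_const.mul (continuous_toCircle_coe.comp continuous_fst)).prodMk
      (continuous_const.mul (continuous_toCircle_coe.comp continuous_snd))
  exact ((fourier (-k 0)).continuous.comp continuous_fst).mul
    (((fourier (-k 1)).continuous.comp continuous_snd).mul h1)

lemma torusCoeff_fst {f : ℂ × ℂ → ℂ} (hf : DifferentiableOn ℂ f bidisc) {t : ℝ}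
    (ht : t ∈ Ico (0 : ℝ) 1) (k : Fin 2 → ℤ) :
    ∃ b : ℂ, (k 0 < 0 → b = 0) ∧ ∀ s ∈ Ico (0 : ℝ) 1,
      torusCoeff f s t k = b * (s : ℂ) ^ (k 0).toNat := by
  have hd : ∀ y : UnitAddCircle, DifferentiableOn ℂ
      (fun z => f (z, (t : ℂ) * (AddCircle.toCircle y : ℂ))) (Metric.ball 0 1) := fun y =>
    hf.comp (by fun_prop) fun z hz => ⟨hz, norm_mul_toCircle_lt ht y⟩
  choose B hB0 hB using fun y => exists_disc_coeff (hd y) (k 0)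
  refine ⟨∫ y, fourier (-k 1) y * B y ∂AddCircle.haarAddCircle, fun h => ?_, fun s hs => ?_⟩
  · simp [hB0 _ h]
  · rw [torusCoeff_iterated, integral_prod_symm _ (integrable_iterated hf hs ht k),
      ← integral_mul_const]
    refine integral_congr_ae (ae_of_all _ fun y => ?_)
    simp only
    rw [mul_assoc, ← hB y s hs, ← integral_const_mul]
    refine integral_congr_ae (ae_of_all _ fun x => ?_)
    simp only
    ring

lemma torusCoeff_snd {f : ℂ × ℂ → ℂ} (hf : DifferentiableOn ℂ f bidisc) {s : ℝ}
    (hs : s ∈ Ico (0 : ℝ) 1) (k : Fin 2 → ℤ) :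
    ∃ b : ℂ, (k 1 < 0 → b = 0) ∧ ∀ t ∈ Ico (0 : ℝ) 1,
      torusCoeff f s t k = b * (t : ℂ) ^ (k 1).toNat := by
  have hd : ∀ y : UnitAddCircle, DifferentiableOn ℂ
      (fun z => f ((s : ℂ) * (AddCircle.toCircle y : ℂ), z)) (Metric.ball 0 1) := fun y =>
    hf.comp (by fun_prop) fun z hz => ⟨norm_mul_toCircle_lt hs y, hz⟩
  choose B hB0 hB using fun y => exists_disc_coeff (hd y) (k 1)
  refine ⟨∫ y, fourier (-k 0) y * B y ∂AddCircle.haarAddCircle, fun h => ?_, fun t ht => ?_⟩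
  · simp [hB0 _ h]
  · rw [torusCoeff_iterated, integral_prod _ (integrable_iterated hf hs ht k),
      ← integral_mul_const]
    refine integral_congr_ae (ae_of_all _ fun y => ?_)
    simp only
    rw [mul_assoc, ← hB y t ht, ← integral_const_mul]

/-- A pair of natural numbers as a multi-index of Fourier coefficients. -/
def index (p : ℕ × ℕ) : Fin 2 → ℤ := ![(p.1 : ℤ), (p.2 : ℤ)]

lemma index_injective : Function.Injective index := fun p q h => by
  have h0 := congrFun h 0
  have h1 := congrFun h 1
  simp [index] at h0 h1
  exact Prod.ext h0 h1

/-- The Taylor coefficient of `z ^ p.1 * w ^ p.2` at the origin. -/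
def taylorCoeff (f : ℂ × ℂ → ℂ) (p : ℕ × ℕ) : ℂ :=
  2 ^ (p.1 + p.2) * torusCoeff f 2⁻¹ 2⁻¹ (index p)

lemma half_mem : (2⁻¹ : ℝ) ∈ Ico (0 : ℝ) 1 := by norm_num

lemma torusCoeff_index {f : ℂ × ℂ → ℂ} (hf : DifferentiableOn ℂ f bidisc) {s t : ℝ}
    (hs : s ∈ Ico (0 : ℝ) 1) (ht : t ∈ Ico (0 : ℝ) 1) (p : ℕ × ℕ) :
    torusCoeff f s t (index p) = taylorCoeff f p * ((s : ℂ) ^ p.1 * (t : ℂ) ^ p.2) := by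
  obtain ⟨b, -, hb⟩ := torusCoeff_fst hf ht (index p)
  obtain ⟨c, -, hc⟩ := torusCoeff_snd hf half_mem (index p)
  have h1 := hb s hs
  have h2 := hb _ half_mem
  have h3 := hc t ht
  have h4 := hc _ half_mem
  simp only [index, Matrix.cons_val_zero, Matrix.cons_val_one, Int.toNat_natCast] at h1 h2 h3 h4
  rw [h3] at h2
  simp only [taylorCoeff, index]
  rw [h1, h4]
  push_cast at h2 ⊢
  have e1 : (2 : ℂ) ^ p.1 * 2⁻¹ ^ p.1 = 1 := by rw [← mul_pow]; norm_num
  have e2 : (2 : ℂ) ^ p.2 * 2⁻¹ ^ p.2 = 1 := by rw [← mul_pow]; norm_num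
  have hb' : b = 2 ^ p.1 * (c * (t : ℂ) ^ p.2) := by
    rw [h2]; linear_combination (-b) * e1
  rw [hb', pow_add]
  linear_combination (-(2 : ℂ) ^ p.1 * c * s ^ p.1 * t ^ p.2) * e2

lemma torusCoeff_eq_zero {f : ℂ × ℂ → ℂ} (hf : DifferentiableOn ℂ f bidisc) {s t : ℝ}
    (hs : s ∈ Ico (0 : ℝ) 1) (ht : t ∈ Ico (0 : ℝ) 1) {k : Fin 2 → ℤ} (hk : k ∉ range index) :
    torusCoeff f s t k = 0 := by
  obtain ⟨b, hb0, hb⟩ := torusCoeff_fst hf ht k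
  obtain ⟨c, hc0, hc⟩ := torusCoeff_snd hf hs k
  by_cases h0 : k 0 < 0
  · rw [hb s hs, hb0 h0, zero_mul]
  by_cases h1 : k 1 < 0
  · rw [hc t ht, hc0 h1, zero_mul]
  refine absurd ⟨((k 0).toNat, (k 1).toNat), ?_⟩ hk
  ext i
  fin_cases i <;> simp [index] <;> omega

/-- Orthogonality of monomials on the torus of radius `t`. -/
lemma hasSum_integral {f g : ℂ × ℂ → ℂ} (hf : DifferentiableOn ℂ f bidisc)
    (hg : DifferentiableOn ℂ g bidisc) {t : ℝ} (ht : t ∈ Ico (0 : ℝ) 1) :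
    HasSum (fun p : ℕ × ℕ => (conj (taylorCoeff f p) * taylorCoeff g p) *
      ((t ^ (p.1 + p.2)) ^ 2 : ℝ))
      (∫ x, conj (f (torusPoint t t x)) * g (torusPoint t t x) ∂torusMeasure) := by
  have h := integral_conj_mul_hasSum (continuous_slice hf ht ht) (continuous_slice hg ht ht)
  change HasSum (fun k => conj (torusCoeff f t t k) * torusCoeff g t t k) _ at h
  rw [← index_injective.hasSum_iff] at h
  · convert h using 1
    ext p
    simp only [Function.comp_apply, torusCoeff_index hf ht ht, torusCoeff_index hg ht ht, map_mul,
      map_pow, Complex.conj_ofReal]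
    push_cast
    ring
  · intro k hk
    rw [torusCoeff_eq_zero hg ht ht hk, mul_zero]

lemma exists_torusPoint (z : ℂ × ℂ) : ∃ x, torusPoint ‖z.1‖ ‖z.2‖ x = z := by
  have h : ∀ u : ℂ, ∃ x : UnitAddCircle, (‖u‖ : ℂ) * (AddCircle.toCircle x : ℂ) = u := fun u =>
    ⟨((u.arg / (2 * Real.pi) : ℝ) : UnitAddCircle), by
      rw [AddCircle.toCircle_apply_mk, Circle.coe_exp]
      conv_rhs => rw [← Complex.norm_mul_exp_arg_mul_I u]
      have : (Real.pi : ℂ) ≠ 0 := by exact_mod_cast Real.pi_ne_zero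
      congr 3
      push_cast
      field_simp⟩
  obtain ⟨x, hx⟩ := h z.1
  obtain ⟨y, hy⟩ := h z.2
  exact ⟨![x, y], Prod.ext (by simpa [torusPoint] using hx) (by simpa [torusPoint] using hy)⟩

lemma summable_geom {r s : ℝ} (hr : r ∈ Ico (0 : ℝ) 1) (hs : s ∈ Ico (0 : ℝ) 1) :
    Summable fun p : ℕ × ℕ => r ^ p.1 * s ^ p.2 :=
  (summable_geometric_of_lt_one hr.1 hr.2).mul_of_nonneg (summable_geometric_of_lt_one hs.1 hs.2)
    (fun _ => pow_nonneg hr.1 _) (fun _ => pow_nonneg hs.1 _)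

/-- A holomorphic function with bounded Taylor coefficients is the sum of its Taylor series. -/
lemma hasSum_taylor {f : ℂ × ℂ → ℂ} (hf : DifferentiableOn ℂ f bidisc) {C : ℝ}
    (hC : ∀ p, ‖taylorCoeff f p‖ ≤ C) {z : ℂ × ℂ} (hz : z ∈ bidisc) :
    HasSum (fun p : ℕ × ℕ => taylorCoeff f p * (z.1 ^ p.1 * z.2 ^ p.2)) (f z) := by
  have h1 : ‖z.1‖ ∈ Ico (0 : ℝ) 1 := ⟨norm_nonneg _, by simpa using hz.1⟩
  have h2 : ‖z.2‖ ∈ Ico (0 : ℝ) 1 := ⟨norm_nonneg _, by simpa using hz.2⟩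
  obtain ⟨x, hx⟩ := exists_torusPoint z
  let F : C(UnitAddTorus (Fin 2), ℂ) := ⟨_, continuous_slice hf h1 h2⟩
  have hF : ∀ k, UnitAddTorus.mFourierCoeff F k = torusCoeff f ‖z.1‖ ‖z.2‖ k := fun k => rfl
  have hs : Summable (UnitAddTorus.mFourierCoeff F) := by
    rw [← index_injective.summable_iff]
    · refine Summable.of_norm_bounded ((summable_geom h1 h2).mul_left C) fun p => ?_
      simp only [Function.comp_apply, hF, torusCoeff_index hf h1 h2, norm_mul, norm_pow,
        Complex.norm_real, norm_norm]
      gcongr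
      exact hC p
    · intro k hk
      rw [hF, torusCoeff_eq_zero hf h1 h2 hk]
  have h := UnitAddTorus.hasSum_mFourier_series_apply_of_summable hs x
  rw [← index_injective.hasSum_iff] at h
  · convert h using 1
    · ext p
      simp only [Function.comp_apply, hF, torusCoeff_index hf h1 h2, smul_eq_mul]
      conv_lhs => rw [← hx]
      simp [torusPoint, UnitAddTorus.mFourier, index, AddCircle.toCircle_nsmul, mul_pow]
      ring
    · conv_lhs => rw [← hx]
      rfl
  · intro k hk
    rw [hF, torusCoeff_eq_zero hf h1 h2 hk, zero_smul]

/-- The mean of `|f|^2` over the torus of radius `t`. -/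
def sqMean (f : ℂ × ℂ → ℂ) (t : ℝ) : ℝ := ∫ x, ‖f (torusPoint t t x)‖ ^ 2 ∂torusMeasure

lemma integrable_sq {f : ℂ × ℂ → ℂ} (hf : DifferentiableOn ℂ f bidisc) {t : ℝ}
    (ht : t ∈ Ico (0 : ℝ) 1) :
    Integrable (fun x => ‖f (torusPoint t t x)‖ ^ 2) torusMeasure :=
  ((continuous_slice hf ht ht).norm.pow 2).integrable_of_hasCompactSupport
    (HasCompactSupport.of_compactSpace _)

/-- Membership in the Hardy space of the bidisc: `f` is holomorphic on the bidisc and its square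
means over the tori of radius `t < 1` are bounded. A function on the bidisc is represented by its
extension by zero to `ℂ × ℂ`, so that equality of functions is equality on the bidisc. -/
structure MemHardy (f : ℂ × ℂ → ℂ) : Prop where
  differentiableOn : DifferentiableOn ℂ f bidisc
  eq_zero : ∀ p, p ∉ bidisc → f p = 0
  bddAbove : BddAbove (sqMean f '' Ico (0 : ℝ) 1)

/-- The vector space of functions underlying the Hardy space of the bidisc. -/
def hardySubmodule : Submodule ℂ (ℂ × ℂ → ℂ) where
  carrier := {f | MemHardy f}
  zero_mem' := ⟨differentiableOn_const 0, fun _ _ => rfl, 0, by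
    rintro _ ⟨t, -, rfl⟩; simp [sqMean]⟩
  add_mem' := by
    rintro f g ⟨hf, hf0, C, hC⟩ ⟨hg, hg0, D, hD⟩
    refine ⟨hf.add hg, fun p hp => by simp [hf0 p hp, hg0 p hp], 2 * (C + D), ?_⟩
    rintro _ ⟨t, ht, rfl⟩
    have h : sqMean (f + g) t ≤ 2 * (sqMean f t + sqMean g t) := by
      unfold sqMean
      rw [← integral_add (integrable_sq hf ht) (integrable_sq hg ht), ← integral_const_mul]
      refine integral_mono (integrable_sq (hf.add hg) ht)
        (((integrable_sq hf ht).add (integrable_sq hg ht)).const_mul 2) fun x => ?_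
      simp only [Pi.add_apply]
      nlinarith [norm_add_le (f (torusPoint t t x)) (g (torusPoint t t x)),
        norm_nonneg (f (torusPoint t t x) + g (torusPoint t t x)),
        sq_nonneg (‖f (torusPoint t t x)‖ - ‖g (torusPoint t t x)‖)]
    linarith [hC (mem_image_of_mem _ ht), hD (mem_image_of_mem _ ht)]
  smul_mem' := by
    rintro c f ⟨hf, hf0, C, hC⟩
    refine ⟨hf.const_smul c, fun p hp => by simp [hf0 p hp], ‖c‖ ^ 2 * C, ?_⟩
    rintro _ ⟨t, ht, rfl⟩
    have h : sqMean (c • f) t = ‖c‖ ^ 2 * sqMean f t := by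
      simp [sqMean, mul_pow, integral_const_mul]
    rw [h]
    exact mul_le_mul_of_nonneg_left (hC (mem_image_of_mem _ ht)) (by positivity)

/-- The Hardy space of the bidisc. -/
def Hardy : Type := hardySubmodule

instance : AddCommGroup Hardy := inferInstanceAs (AddCommGroup hardySubmodule)
instance : Module ℂ Hardy := inferInstanceAs (Module ℂ hardySubmodule)

namespace Hardy

/-- The function on the bidisc, extended by zero. -/
def toFun (f : Hardy) : ℂ × ℂ → ℂ := Subtype.val f

/-- The element of the Hardy space given by a function. -/
def mk (f : ℂ × ℂ → ℂ) (hf : MemHardy f) : Hardy := ⟨f, hf⟩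

instance : CoeFun Hardy fun _ => ℂ × ℂ → ℂ := ⟨toFun⟩

/-- The inner product of the Hardy space: the limit of the means of `conj f * g` over the tori of
radius `t` as `t` increases to one. -/
def innerProd (f g : Hardy) : ℂ :=
  limUnder (𝓝[<] (1 : ℝ)) fun t =>
    ∫ x, conj (f (torusPoint t t x)) * g (torusPoint t t x) ∂torusMeasure

lemma memHardy (f : Hardy) : MemHardy f := f.2

@[simp] lemma mk_apply (f : ℂ × ℂ → ℂ) (hf : MemHardy f) (p : ℂ × ℂ) : mk f hf p = f p := rfl

@[ext] lemma ext {f g : Hardy} (h : ∀ p ∈ bidisc, f p = g p) : f = g := by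
  refine Subtype.ext (funext fun p => ?_)
  by_cases hp : p ∈ bidisc
  · exact h p hp
  · exact (f.memHardy.eq_zero p hp).trans (g.memHardy.eq_zero p hp).symm

@[simp] lemma add_apply (f g : Hardy) (p : ℂ × ℂ) : (f + g) p = f p + g p := rfl
@[simp] lemma smul_apply (c : ℂ) (f : Hardy) (p : ℂ × ℂ) : (c • f) p = c * f p := rfl

lemma differentiableOn (f : Hardy) : DifferentiableOn ℂ f bidisc :=
  f.memHardy.differentiableOn

end Hardy

lemma hasSum_sqMean {f : ℂ × ℂ → ℂ} (hf : DifferentiableOn ℂ f bidisc) {t : ℝ}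
    (ht : t ∈ Ico (0 : ℝ) 1) :
    HasSum (fun p : ℕ × ℕ => ‖taylorCoeff f p‖ ^ 2 * (t ^ (p.1 + p.2)) ^ 2) (sqMean f t) := by
  have h := hasSum_integral hf hf ht
  rw [← Complex.hasSum_ofReal]
  convert h using 1
  · ext p
    rw [Complex.conj_mul']
    push_cast
    ring
  · unfold sqMean
    rw [← integral_complex_ofReal]
    congr 1
    ext x
    rw [Complex.conj_mul']
    push_cast
    rfl

lemma tendsto_pow_sq (n : ℕ) : Tendsto (fun t : ℝ => (t ^ n) ^ 2) (𝓝[<] 1) (𝓝 1) := by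
  have : Continuous fun t : ℝ => (t ^ n) ^ 2 := by fun_prop
  simpa using (this.tendsto 1).mono_left nhdsWithin_le_nhds

lemma eventually_mem : ∀ᶠ t in 𝓝[<] (1 : ℝ), t ∈ Ico (0 : ℝ) 1 :=
  Ico_mem_nhdsLT one_pos

lemma memlp_taylorCoeff (f : Hardy) : Memℓp (taylorCoeff f) 2 := by
  obtain ⟨C, hC⟩ := f.memHardy.bddAbove
  refine memℓp_gen ?_
  simp only [ENNReal.toReal_ofNat, Real.rpow_two]
  refine summable_of_sum_le (c := C) (fun _ => by positivity) fun u => ?_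
  have h1 : Tendsto (fun t : ℝ => ∑ p ∈ u, ‖taylorCoeff f p‖ ^ 2 * (t ^ (p.1 + p.2)) ^ 2)
      (𝓝[<] 1) (𝓝 (∑ p ∈ u, ‖taylorCoeff f p‖ ^ 2 * 1)) :=
    tendsto_finsetSum _ fun p _ => (tendsto_pow_sq _).const_mul _
  simp only [mul_one] at h1
  refine le_of_tendsto h1 ?_
  filter_upwards [eventually_mem] with t ht
  exact (sum_le_hasSum u (fun _ _ => by positivity) (hasSum_sqMean f.differentiableOn ht)).trans
    (hC (mem_image_of_mem _ ht))

lemma taylorCoeff_add (f g : Hardy) (p : ℕ × ℕ) :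
    taylorCoeff (f + g : Hardy) p = taylorCoeff f p + taylorCoeff g p := by
  have hi : ∀ h : Hardy, Integrable (fun x => UnitAddTorus.mFourier (-index p) x *
      h (torusPoint 2⁻¹ 2⁻¹ x)) torusMeasure := fun h =>
    ((UnitAddTorus.mFourier (-index p)).continuous.mul
      (continuous_slice h.differentiableOn half_mem half_mem)).integrable_of_hasCompactSupport
      (HasCompactSupport.of_compactSpace _)
  unfold taylorCoeff torusCoeff
  rw [← mul_add, ← integral_add (hi f) (hi g)]
  simp only [Hardy.add_apply, mul_add]

lemma taylorCoeff_smul (c : ℂ) (f : Hardy) (p : ℕ × ℕ) :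
    taylorCoeff (c • f : Hardy) p = c * taylorCoeff f p := by
  unfold taylorCoeff torusCoeff
  simp only [Hardy.smul_apply, mul_left_comm _ c, integral_const_mul]

/-- The sequence of Taylor coefficients. -/
def coeffMap : Hardy →ₗ[ℂ] lp (fun _ : ℕ × ℕ => ℂ) 2 where
  toFun f := ⟨taylorCoeff f, memlp_taylorCoeff f⟩
  map_add' f g := by ext p; exact taylorCoeff_add f g p
  map_smul' c f := by ext p; exact taylorCoeff_smul c f p

lemma coeffMap_apply (f : Hardy) (p : ℕ × ℕ) : coeffMap f p = taylorCoeff f p := rfl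

lemma tendsto_inner (f g : Hardy) :
    Tendsto (fun t : ℝ => ∫ x, conj (f (torusPoint t t x)) * g (torusPoint t t x) ∂torusMeasure)
      (𝓝[<] 1) (𝓝 (inner ℂ (coeffMap f) (coeffMap g))) := by
  have hs := lp.summable_inner (𝕜 := ℂ) (coeffMap f) (coeffMap g)
  rw [lp.inner_eq_tsum]
  have h := tendsto_tsum_of_dominated_convergence (𝓕 := 𝓝[<] (1 : ℝ))
    (f := fun (t : ℝ) (p : ℕ × ℕ) => (conj (taylorCoeff f p) * taylorCoeff g p) *
      ((t ^ (p.1 + p.2)) ^ 2 : ℝ)) (g := fun p => inner ℂ (coeffMap f p) (coeffMap g p))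
    hs.norm (fun p => ?_) ?_
  · refine h.congr' ?_
    filter_upwards [eventually_mem] with t ht
    exact (hasSum_integral f.differentiableOn g.differentiableOn ht).tsum_eq
  · have := (Complex.continuous_ofReal.tendsto 1).comp (tendsto_pow_sq (p.1 + p.2))
    simpa [coeffMap_apply, mul_comm] using this.const_mul (conj (taylorCoeff f p) * taylorCoeff g p)
  · filter_upwards [eventually_mem] with t ht p
    have h1 : |(t ^ (p.1 + p.2)) ^ 2| ≤ 1 := by
      rw [abs_of_nonneg (by positivity)]
      exact pow_le_one₀ (pow_nonneg ht.1 _) (pow_le_one₀ ht.1 ht.2.le)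
    rw [norm_mul, Complex.norm_real, Real.norm_eq_abs]
    refine (mul_le_of_le_one_right (norm_nonneg _) h1).trans (le_of_eq ?_)
    simp [coeffMap_apply, mul_comm]

lemma innerProd_eq (f g : Hardy) : f.innerProd g = inner ℂ (coeffMap f) (coeffMap g) :=
  (tendsto_inner f g).limUnder_eq

lemma norm_taylorCoeff_le (f : Hardy) (p : ℕ × ℕ) : ‖taylorCoeff f p‖ ≤ ‖coeffMap f‖ :=
  lp.norm_apply_le_norm (by norm_num) (coeffMap f) p

lemma Hardy.hasSum (f : Hardy) {z : ℂ × ℂ} (hz : z ∈ bidisc) :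
    HasSum (fun p : ℕ × ℕ => taylorCoeff f p * (z.1 ^ p.1 * z.2 ^ p.2)) (f z) :=
  hasSum_taylor f.differentiableOn (norm_taylorCoeff_le f) hz

lemma coeffMap_injective : Function.Injective coeffMap := by
  rw [← LinearMap.ker_eq_bot, LinearMap.ker_eq_bot']
  intro f hf
  ext z hz
  have h : ∀ p, taylorCoeff f p = 0 := fun p => by rw [← coeffMap_apply, hf]; rfl
  have := f.hasSum hz
  simp only [h, zero_mul] at this
  exact this.unique hasSum_zero

/-- The inner product turns the Hardy space into an inner product space. -/
@[reducible] def innerCore : InnerProductSpace.Core ℂ Hardy where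
  inner := Hardy.innerProd
  conj_inner_symm f g := by rw [innerProd_eq, innerProd_eq, inner_conj_symm]
  re_inner_nonneg f := by rw [innerProd_eq]; exact inner_self_nonneg
  add_left f g h := by simp only [innerProd_eq, map_add, inner_add_left]
  smul_left f g c := by simp only [innerProd_eq, map_smul, inner_smul_left]
  definite f hf := by
    rw [innerProd_eq, inner_self_eq_zero] at hf
    exact coeffMap_injective (hf.trans (map_zero _).symm)

instance : NormedAddCommGroup Hardy := innerCore.toNormedAddCommGroup
instance : InnerProductSpace ℂ Hardy := InnerProductSpace.ofCore innerCore.toCore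

lemma Hardy.inner_def (f g : Hardy) : inner ℂ f g = limUnder (𝓝[<] (1 : ℝ)) fun t =>
    ∫ x, conj (f (torusPoint t t x)) * g (torusPoint t t x) ∂torusMeasure := rfl

lemma inner_coeffMap (f g : Hardy) : inner ℂ (coeffMap f) (coeffMap g) = inner ℂ f g :=
  (innerProd_eq f g).symm

lemma norm_coeffMap (f : Hardy) : ‖coeffMap f‖ = ‖f‖ := by
  rw [@norm_eq_sqrt_re_inner ℂ, inner_coeffMap, ← @norm_eq_sqrt_re_inner ℂ]

lemma tendsto_sqMean (f : Hardy) : Tendsto (sqMean f) (𝓝[<] 1) (𝓝 (‖f‖ ^ 2)) := by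
  have h := tendsto_inner f f
  rw [inner_coeffMap, inner_self_eq_norm_sq_to_K] at h
  have h' := (Complex.continuous_re.tendsto _).comp h
  have e : (((‖f‖ : ℝ) : ℂ) ^ 2).re = ‖f‖ ^ 2 := by rw [← Complex.ofReal_pow, Complex.ofReal_re]
  erw [e] at h'
  refine h'.congr fun t => ?_
  simp only [Function.comp_apply, Complex.conj_mul']
  have : ∀ x, ((‖f (torusPoint t t x)‖ : ℂ) ^ 2) = ((‖f (torusPoint t t x)‖ ^ 2 : ℝ) : ℂ) :=
    fun x => by push_cast; rfl
  simp_rw [this]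
  rw [integral_complex_ofReal, Complex.ofReal_re]
  rfl

lemma hasFDerivAt_monomial (a : ℂ) (p : ℕ × ℕ) (z : ℂ × ℂ) :
    HasFDerivAt (fun z : ℂ × ℂ => a * (z.1 ^ p.1 * z.2 ^ p.2))
      (a • (z.1 ^ p.1 • ((p.2 : ℂ) * z.2 ^ (p.2 - 1)) • ContinuousLinearMap.snd ℂ ℂ ℂ +
        z.2 ^ p.2 • ((p.1 : ℂ) * z.1 ^ (p.1 - 1)) • ContinuousLinearMap.fst ℂ ℂ ℂ)) z := by
  have h1 : HasFDerivAt (fun z : ℂ × ℂ => z.1 ^ p.1)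
      (((p.1 : ℂ) * z.1 ^ (p.1 - 1)) • ContinuousLinearMap.fst ℂ ℂ ℂ) z :=
    (hasDerivAt_pow p.1 z.1).comp_hasFDerivAt z hasFDerivAt_fst
  have h2 : HasFDerivAt (fun z : ℂ × ℂ => z.2 ^ p.2)
      (((p.2 : ℂ) * z.2 ^ (p.2 - 1)) • ContinuousLinearMap.snd ℂ ℂ ℂ) z :=
    (hasDerivAt_pow p.2 z.2).comp_hasFDerivAt z hasFDerivAt_snd
  exact (h1.mul h2).const_mul a

lemma summable_nat_mul_pow {r : ℝ} (hr : r ∈ Ico (0 : ℝ) 1) :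
    Summable fun n : ℕ => (n : ℝ) * r ^ (n - 1) := by
  rw [← summable_nat_add_iff 1]
  have h1 := summable_pow_mul_geometric_of_norm_lt_one (R := ℝ) 1
    (r := r) (by rw [Real.norm_eq_abs, abs_of_nonneg hr.1]; exact hr.2)
  refine (h1.add (summable_geometric_of_lt_one hr.1 hr.2)).congr fun n => ?_
  simp
  ring

/-- The sum of a power series with square summable coefficients, extended by zero. -/
def powerSum (a : ℕ × ℕ → ℂ) (z : ℂ × ℂ) : ℂ := by
  classical exact if z ∈ bidisc then ∑' p : ℕ × ℕ, a p * (z.1 ^ p.1 * z.2 ^ p.2) else 0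

lemma powerSum_of_mem (a : ℕ × ℕ → ℂ) {z : ℂ × ℂ} (hz : z ∈ bidisc) :
    powerSum a z = ∑' p : ℕ × ℕ, a p * (z.1 ^ p.1 * z.2 ^ p.2) := if_pos hz

lemma differentiableOn_powerSum {a : ℕ × ℕ → ℂ} {C : ℝ} (hC : ∀ p, ‖a p‖ ≤ C) :
    DifferentiableOn ℂ (powerSum a) bidisc := by
  have hC0 : 0 ≤ C := (norm_nonneg _).trans (hC (0, 0))
  refine DifferentiableOn.congr (f := fun z : ℂ × ℂ => ∑' p : ℕ × ℕ, a p * (z.1 ^ p.1 * z.2 ^ p.2))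
    ?_ fun z hz => powerSum_of_mem a hz
  intro z hz
  have hz1 : ‖z‖ < 1 := by
    rw [bidisc, ball_prod_same] at hz
    exact mem_ball_zero_iff.mp hz
  obtain ⟨r, hzr, hr1⟩ := exists_between hz1
  have hr : r ∈ Ico (0 : ℝ) 1 := ⟨(norm_nonneg z).trans hzr.le, hr1⟩
  have hu : Summable fun p : ℕ × ℕ =>
      C * (r ^ p.1 * ((p.2 : ℝ) * r ^ (p.2 - 1)) + ((p.1 : ℝ) * r ^ (p.1 - 1)) * r ^ p.2) := by
    have hg := summable_geometric_of_lt_one hr.1 hr.2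
    have hn := summable_nat_mul_pow hr
    have p1 : ∀ n : ℕ, 0 ≤ r ^ n := fun n => pow_nonneg hr.1 n
    have p2 : ∀ n : ℕ, 0 ≤ (n : ℝ) * r ^ (n - 1) := fun n => mul_nonneg n.cast_nonneg (p1 _)
    exact ((hg.mul_of_nonneg hn p1 p2).add (hn.mul_of_nonneg hg p2 p1)).mul_left C
  refine (hasFDerivAt_tsum_of_isPreconnected hu (Metric.isOpen_ball (x := (0 : ℂ × ℂ)) (ε := r))
    (convex_ball _ _).isPreconnected (fun p y _ => hasFDerivAt_monomial (a p) p y) ?_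
    (x₀ := 0) (Metric.mem_ball_self ((norm_nonneg z).trans_lt hzr)) ?_
    (mem_ball_zero_iff.mpr hzr)).differentiableAt.differentiableWithinAt
  · intro p y hy
    have hy' : ‖y‖ < r := mem_ball_zero_iff.mp hy
    have y1 : ‖y.1‖ ≤ r := (norm_fst_le y).trans hy'.le
    have y2 : ‖y.2‖ ≤ r := (norm_snd_le y).trans hy'.le
    rw [norm_smul]
    refine mul_le_mul (hC p) ?_ (norm_nonneg _) hC0
    refine (norm_add_le _ _).trans (add_le_add ?_ ?_)
    · rw [norm_smul, norm_smul, norm_mul, norm_pow, norm_pow, Complex.norm_natCast]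
      calc _ ≤ r ^ p.1 * ((p.2 : ℝ) * r ^ (p.2 - 1) * 1) := by
            have := ContinuousLinearMap.norm_snd_le ℂ ℂ ℂ
            have := hr.1
            gcongr
        _ = _ := by ring
    · rw [norm_smul, norm_smul, norm_mul, norm_pow, norm_pow, Complex.norm_natCast]
      calc _ ≤ r ^ p.2 * ((p.1 : ℝ) * r ^ (p.1 - 1) * 1) := by
            have := ContinuousLinearMap.norm_fst_le ℂ ℂ ℂ
            have := hr.1
            gcongr
        _ = _ := by ring
  · refine summable_of_ne_finset_zero (s := {(0, 0)}) fun p hp => ?_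
    have : p.1 ≠ 0 ∨ p.2 ≠ 0 := by
      by_contra! h
      exact hp (Finset.mem_singleton.mpr (Prod.ext h.1 h.2))
    rcases this with h | h <;> simp [h]

lemma taylorCoeff_powerSum {a : ℕ × ℕ → ℂ} {C : ℝ} (hC : ∀ p, ‖a p‖ ≤ C) (q : ℕ × ℕ) :
    taylorCoeff (powerSum a) q = a q := by
  classical
  have e : ∀ x, UnitAddTorus.mFourier (-index q) x * powerSum a (torusPoint 2⁻¹ 2⁻¹ x) =
      ∑' p : ℕ × ℕ, (a p * (2⁻¹ ^ p.1 * 2⁻¹ ^ p.2)) *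
        (UnitAddTorus.mFourier (-index q) x * UnitAddTorus.mFourier (index p) x) := by
    intro x
    rw [powerSum_of_mem _ (torusPoint_mem half_mem half_mem x), ← tsum_mul_left]
    congr 1
    ext p
    have : UnitAddTorus.mFourier (index p) x =
        (AddCircle.toCircle (x 0) : ℂ) ^ p.1 * (AddCircle.toCircle (x 1) : ℂ) ^ p.2 := by
      simp [UnitAddTorus.mFourier, index, AddCircle.toCircle_nsmul]
    rw [this]
    simp only [torusPoint, mul_pow]
    push_cast
    ring
  unfold taylorCoeff torusCoeff
  simp_rw [e]
  have hc : ∀ p : ℕ × ℕ, Continuous fun x => (a p * (2⁻¹ ^ p.1 * 2⁻¹ ^ p.2)) *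
        (UnitAddTorus.mFourier (-index q) x * UnitAddTorus.mFourier (index p) x) :=
    fun p => by fun_prop
  rw [← integral_tsum_of_summable_integral_norm
    (fun p => (hc p).integrable_of_hasCompactSupport (HasCompactSupport.of_compactSpace _))]
  · simp_rw [integral_const_mul, integral_mFourier]
    rw [tsum_eq_single q]
    · rw [if_pos rfl, mul_one, pow_add]
      have e1 : (2 : ℂ) ^ q.1 * 2⁻¹ ^ q.1 = 1 := by rw [← mul_pow]; norm_num
      have e2 : (2 : ℂ) ^ q.2 * 2⁻¹ ^ q.2 = 1 := by rw [← mul_pow]; norm_num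
      linear_combination a q * (2 : ℂ) ^ q.2 * 2⁻¹ ^ q.2 * e1 + a q * e2
    · intro p hp
      rw [if_neg fun h => hp (index_injective h).symm, mul_zero]
  · have hm : ∀ (k : Fin 2 → ℤ) x, ‖UnitAddTorus.mFourier k x‖ = 1 := fun k x => by
      simp [UnitAddTorus.mFourier, Circle.norm_coe]
    refine Summable.of_nonneg_of_le (fun p => integral_nonneg fun x => norm_nonneg _) (fun p => ?_)
      ((summable_geom half_mem half_mem).mul_left C)
    simp only [norm_mul, hm, mul_one, integral_const, probReal_univ, one_smul, norm_pow, norm_inv,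
      Complex.norm_ofNat]
    gcongr
    exact hC p

lemma coeffMap_surjective : Function.Surjective coeffMap := by
  intro a
  have hC : ∀ p, ‖a p‖ ≤ ‖a‖ := fun p => lp.norm_apply_le_norm (by norm_num) a p
  have hd := differentiableOn_powerSum hC
  refine ⟨Hardy.mk (powerSum a) ⟨hd, fun z hz => if_neg hz, ∑' p, ‖a p‖ ^ 2, ?_⟩, ?_⟩
  · rintro _ ⟨t, ht, rfl⟩
    have h := hasSum_sqMean hd ht
    simp only [taylorCoeff_powerSum hC] at h
    have hs : Summable fun p => ‖a p‖ ^ 2 := by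
      simpa using (lp.memℓp a).summable (by norm_num)
    refine hasSum_le (fun p => ?_) h hs.hasSum
    refine mul_le_of_le_one_right (by positivity) ?_
    exact pow_le_one₀ (pow_nonneg ht.1 _) (pow_le_one₀ ht.1 ht.2.le)
  · ext p
    exact taylorCoeff_powerSum hC p

/-- Taylor coefficients identify the Hardy space with the square summable double sequences. -/
def coeffEquiv : Hardy ≃ₗᵢ[ℂ] lp (fun _ : ℕ × ℕ => ℂ) 2 where
  toLinearEquiv := LinearEquiv.ofBijective coeffMap ⟨coeffMap_injective, coeffMap_surjective⟩
  norm_map' := norm_coeffMap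

instance : CompleteSpace Hardy :=
  (completeSpace_congr (e := coeffEquiv.toEquiv) coeffEquiv.isometry.isUniformEmbedding).mpr
    inferInstance

/-- Pointwise multiplication by a linear functional which is bounded by one on the bidisc. -/
def mulLin (c : ℂ × ℂ →L[ℂ] ℂ) (hc : ∀ p, ‖c p‖ ≤ ‖p‖) : Hardy →L[ℂ] Hardy :=
  have hle : ∀ (f : ℂ × ℂ → ℂ), DifferentiableOn ℂ f bidisc → ∀ t ∈ Ico (0 : ℝ) 1,
      sqMean (fun p => c p * f p) t ≤ sqMean f t := fun f hf t ht => by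
    refine integral_mono (integrable_sq (c.differentiable.differentiableOn.mul hf) ht)
      (integrable_sq hf ht) fun x => ?_
    have h1 : ‖c (torusPoint t t x)‖ ≤ 1 := by
      refine (hc _).trans ?_
      have := torusPoint_mem ht ht x
      rw [bidisc, ball_prod_same] at this
      exact (mem_ball_zero_iff.mp this).le
    simp only [norm_mul]
    gcongr
    exact mul_le_of_le_one_left (norm_nonneg _) h1
  LinearMap.mkContinuous
    { toFun := fun f => Hardy.mk (fun p => c p * f p)
        ⟨c.differentiable.differentiableOn.mul f.differentiableOn,
        fun p hp => by rw [f.memHardy.eq_zero p hp, mul_zero], by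
          obtain ⟨C, hC⟩ := f.memHardy.bddAbove
          refine ⟨C, ?_⟩
          rintro _ ⟨t, ht, rfl⟩
          exact (hle f f.differentiableOn t ht).trans (hC (mem_image_of_mem _ ht))⟩
      map_add' := fun f g => Hardy.ext fun p _ => mul_add _ _ _
      map_smul' := fun a f => Hardy.ext fun p _ => mul_left_comm _ _ _ } 1 fun f => by
    rw [one_mul]
    refine (sq_le_sq₀ (norm_nonneg _) (norm_nonneg _)).mp ?_
    refine le_of_tendsto_of_tendsto (tendsto_sqMean _) (tendsto_sqMean f) ?_
    filter_upwards [eventually_mem] with t ht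
    exact hle f f.differentiableOn t ht

/-- Multiplication by the first coordinate function. -/
def M₁ : Hardy →L[ℂ] Hardy := mulLin (ContinuousLinearMap.fst ℂ ℂ ℂ) norm_fst_le
/-- Multiplication by the second coordinate function. -/
def M₂ : Hardy →L[ℂ] Hardy := mulLin (ContinuousLinearMap.snd ℂ ℂ ℂ) norm_snd_le

lemma M₁_apply (f : Hardy) (p : ℂ × ℂ) : M₁ f p = p.1 * f p := rfl
lemma M₂_apply (f : Hardy) (p : ℂ × ℂ) : M₂ f p = p.2 * f p := rfl

/-- The compression `P_Q T|_Q` of an operator to a closed subspace `Q`. -/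
def compression (Q : Submodule ℂ Hardy) [CompleteSpace Q] (T : Hardy →L[ℂ] Hardy) : Q →L[ℂ] Q :=
  Q.orthogonalProjectionOnto ∘L T ∘L Q.subtypeL

/-- Quotient modules: closed subspaces invariant under the adjoints of both multiplications. -/
def IsQuotientModule (Q : Submodule ℂ Hardy) : Prop :=
  IsClosed (Q : Set Hardy) ∧ (∀ f ∈ Q, ContinuousLinearMap.adjoint M₁ f ∈ Q) ∧ ∀ f ∈ Q, ContinuousLinearMap.adjoint M₂ f ∈ Q

/-- A quotient module `Q` with `Q₁ Q₂ Q₂* = Q₂* Q₁ Q₂`, where `Q₁, Q₂` are the compressions of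
`M₁, M₂` to `Q`. -/
structure IsPhiDoublyCommuting (Q : Submodule ℂ Hardy) [CompleteSpace Q] : Prop where
  quotientModule : IsQuotientModule Q
  comm : compression Q M₁ ∘L compression Q M₂ ∘L ContinuousLinearMap.adjoint (compression Q M₂) =
    ContinuousLinearMap.adjoint (compression Q M₂) ∘L compression Q M₁ ∘L compression Q M₂

/-- The subspace `q H²` of all products of `q` with a function in the Hardy space, for a bounded
holomorphic function `q` on the bidisc. -/
def mulHardy (q : ℂ × ℂ → ℂ) : Submodule ℂ Hardy where
  carrier := {g | ∃ h : Hardy, ∀ p ∈ bidisc, g p = q p * h p}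
  zero_mem' := ⟨0, fun p _ => (mul_zero _).symm⟩
  add_mem' := by
    rintro f g ⟨h, hh⟩ ⟨k, hk⟩
    exact ⟨h + k, fun p hp => by simp [hh p hp, hk p hp, mul_add]⟩
  smul_mem' := by
    rintro c f ⟨h, hh⟩
    exact ⟨c • h, fun p hp => by simp [hh p hp, mul_left_comm]⟩

/-- Inner functions on the unit disc: bounded holomorphic functions whose radial limits exist and
have modulus one at almost every point of the unit circle. -/
structure IsInner (θ : ℂ → ℂ) : Prop where
  differentiableOn : DifferentiableOn ℂ θ (Metric.ball 0 1)
  bounded : ∃ C : ℝ, ∀ z ∈ Metric.ball (0 : ℂ) 1, ‖θ z‖ ≤ C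
  radial : ∀ᵐ x : UnitAddCircle ∂AddCircle.haarAddCircle, ∃ l : ℂ, ‖l‖ = 1 ∧
    Tendsto (fun r : ℝ => θ ((r : ℂ) * (AddCircle.toCircle x : ℂ))) (𝓝[<] 1) (𝓝 l)

end BidiscHardy
end

/-!
Let `q(z, w) = θ₁(z) θ₂(w)` and let `V` be multiplication by `q`, an isometry of `H²`. Compressions
of `M₁` and `M₂` to a quotient module `Q` multiply as `M₁` and `M₂` do, so `Q` is `φ`-doubly
commuting iff `P_Q M₁ M₂ M₂* = M₂* P_Q M₁ M₂` on `Q`. If `f ∈ Q ∩ ker M₂*`, the left side vanishes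
at `f`, so `P_Q M₁ M₂ f` is in `ker M₂*` and hence orthogonal to `M₂ M₁ f = M₁ M₂ f`; thus
`M₁ M₂ f ∈ Qᗮ = q H²`.

Take for `f` the reproducing kernel at `(a, 0)`, where `θ₁ a = 0`. It has no zeros, and `q` divides
`z w f`, so `q` vanishes only on the axes and the zeros of `θ₁` and `θ₂` are at the origin. With
`a = 0` this reads `z w = q G`. Since `q H² ⊆ z H²`, the function `w`, being orthogonal to `z H²`,
is killed by `V*`, so `M₁* G = M₁* V* (z w) = V* w = 0`. Likewise `M₂* G = 0`, so `G` is constant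
and `z w` is a multiple of `θ₁(z) θ₂(w)`.
-/

noncomputable section

namespace BidiscHardy

open Set Filter Topology MeasureTheory Metric
open scoped ComplexConjugate InnerProductSpace
open ContinuousLinearMap
  (adjoint adjoint_comp adjoint_inner_left adjoint_inner_right comp_apply)

section Multipliers

/-- Bounded holomorphic functions on the bidisc, which act on the Hardy space by multiplication. -/
structure IsMultiplier (q : ℂ × ℂ → ℂ) : Prop where
  differentiableOn : DifferentiableOn ℂ q bidisc
  bounded : ∃ C : ℝ, ∀ p ∈ bidisc, ‖q p‖ ≤ C

lemma zero_mem_bidisc : (0 : ℂ × ℂ) ∈ bidisc :=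
  ⟨mem_ball_self one_pos, mem_ball_self one_pos⟩

lemma fst_axis_mem_bidisc {z : ℂ} (hz : z ∈ ball 0 1) : (z, (0 : ℂ)) ∈ bidisc :=
  ⟨hz, mem_ball_self one_pos⟩

lemma snd_axis_mem_bidisc {w : ℂ} (hw : w ∈ ball 0 1) : ((0 : ℂ), w) ∈ bidisc :=
  ⟨mem_ball_self one_pos, hw⟩

lemma sqMean_mul_le {q f : ℂ × ℂ → ℂ} (hq : DifferentiableOn ℂ q bidisc) {C : ℝ}
    (hC : ∀ p ∈ bidisc, ‖q p‖ ≤ C) (hf : DifferentiableOn ℂ f bidisc) {t : ℝ}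
    (ht : t ∈ Ico (0 : ℝ) 1) : sqMean (fun p => q p * f p) t ≤ C ^ 2 * sqMean f t := by
  unfold sqMean
  rw [← integral_const_mul]
  refine integral_mono (integrable_sq (hq.mul hf) ht) ((integrable_sq hf ht).const_mul _)
    fun x => ?_
  have := hC _ (torusPoint_mem ht ht x)
  simp only [norm_mul, mul_pow]
  gcongr

lemma IsMultiplier.memHardy_mul {q : ℂ × ℂ → ℂ} (hq : IsMultiplier q) (f : Hardy) :
    MemHardy fun p => q p * f p := by
  obtain ⟨C, hC⟩ := hq.bounded
  obtain ⟨D, hD⟩ := f.memHardy.bddAbove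
  refine ⟨hq.differentiableOn.mul f.differentiableOn,
    fun p hp => by rw [f.memHardy.eq_zero p hp, mul_zero], C ^ 2 * D, ?_⟩
  rintro _ ⟨t, ht, rfl⟩
  calc sqMean (fun p => q p * f p) t ≤ C ^ 2 * sqMean f t :=
        sqMean_mul_le hq.differentiableOn hC f.differentiableOn ht
    _ ≤ C ^ 2 * D := by gcongr; exact hD (mem_image_of_mem _ ht)

/-- The operator of multiplication by a bounded holomorphic function on the Hardy space. -/
def mulOp {q : ℂ × ℂ → ℂ} (hq : IsMultiplier q) : Hardy →L[ℂ] Hardy :=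
  LinearMap.mkContinuous
    { toFun := fun f => Hardy.mk _ (hq.memHardy_mul f)
      map_add' := fun f g => Hardy.ext fun p _ => mul_add _ _ _
      map_smul' := fun a f => Hardy.ext fun p _ => mul_left_comm _ _ _ }
    hq.bounded.choose fun f => by
    have hC := hq.bounded.choose_spec
    have hC0 : 0 ≤ hq.bounded.choose := (norm_nonneg _).trans (hC 0 zero_mem_bidisc)
    refine (sq_le_sq₀ (norm_nonneg _) (mul_nonneg hC0 (norm_nonneg _))).mp ?_
    rw [mul_pow]
    refine le_of_tendsto_of_tendsto (tendsto_sqMean _) ((tendsto_sqMean f).const_mul _) ?_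
    filter_upwards [eventually_mem] with t ht
    exact sqMean_mul_le hq.differentiableOn hC f.differentiableOn ht

variable {q r : ℂ × ℂ → ℂ}

lemma mulOp_apply (hq : IsMultiplier q) (f : Hardy) (p : ℂ × ℂ) : mulOp hq f p = q p * f p := rfl

lemma mulOp_comp_comm (hq : IsMultiplier q) (hr : IsMultiplier r) :
    mulOp hq ∘L mulOp hr = mulOp hr ∘L mulOp hq :=
  ContinuousLinearMap.ext fun _ => Hardy.ext fun _ _ => mul_left_comm _ _ _

lemma adjoint_mulOp_comm (hq : IsMultiplier q) (hr : IsMultiplier r) (f : Hardy) :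
    adjoint (mulOp hq) (adjoint (mulOp hr) f) = adjoint (mulOp hr) (adjoint (mulOp hq) f) := by
  rw [← comp_apply, ← adjoint_comp, mulOp_comp_comm, adjoint_comp, comp_apply]

lemma mulHardy_eq_range (hq : IsMultiplier q) : mulHardy q = (mulOp hq).range := by
  ext f
  exact exists_congr fun h => ⟨fun hh => Hardy.ext fun p hp => (hh p hp).symm,
    fun hh p _ => by rw [← hh]; rfl⟩

lemma mem_mulHardy_orthogonal_iff (hq : IsMultiplier q) {f : Hardy} :
    f ∈ (mulHardy q)ᗮ ↔ adjoint (mulOp hq) f = 0 := by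
  rw [mulHardy_eq_range hq, ContinuousLinearMap.orthogonal_range, LinearMap.mem_ker]
  rfl

end Multipliers

section Kernel

lemma norm_conj_mul_lt_one {z w : ℂ} (hz : z ∈ ball 0 1) (hw : w ∈ ball 0 1) :
    ‖conj z * w‖ < 1 := by
  rw [norm_mul, RCLike.norm_conj]
  exact mul_lt_one_of_nonneg_of_lt_one_left (norm_nonneg z) (mem_ball_zero_iff.mp hz)
    (mem_ball_zero_iff.mp hw).le

lemma one_sub_conj_mul_ne_zero {z w : ℂ} (hz : z ∈ ball 0 1) (hw : w ∈ ball 0 1) :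
    1 - conj z * w ≠ 0 := fun h =>
  (norm_conj_mul_lt_one hz hw).ne (by rw [← sub_eq_zero.mp h, norm_one])

lemma memℓp_conj_monomial {z : ℂ × ℂ} (hz : z ∈ bidisc) :
    Memℓp (fun p : ℕ × ℕ => conj (z.1 ^ p.1 * z.2 ^ p.2)) 2 := by
  have hsq {u : ℂ} (hu : u ∈ ball 0 1) : ‖u‖ ^ 2 ∈ Ico (0 : ℝ) 1 :=
    ⟨by positivity, pow_lt_one₀ (norm_nonneg _) (mem_ball_zero_iff.mp hu) two_ne_zero⟩
  refine memℓp_gen ((summable_geom (hsq hz.1) (hsq hz.2)).congr fun p => ?_)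
  simp [mul_pow, ← pow_mul, mul_comm]

/-- The reproducing kernel of the Hardy space at a point of the bidisc, given by its Taylor
coefficients. -/
def kernel {z : ℂ × ℂ} (hz : z ∈ bidisc) : Hardy := coeffEquiv.symm ⟨_, memℓp_conj_monomial hz⟩

lemma coeffMap_kernel {z : ℂ × ℂ} (hz : z ∈ bidisc) :
    coeffMap (kernel hz) = ⟨_, memℓp_conj_monomial hz⟩ :=
  coeffEquiv.apply_symm_apply _

lemma inner_kernel_left {z : ℂ × ℂ} (hz : z ∈ bidisc) (f : Hardy) : ⟪kernel hz, f⟫_ℂ = f z := by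
  rw [← inner_coeffMap, coeffMap_kernel, lp.inner_eq_tsum, ← (f.hasSum hz).tsum_eq]
  congr 1
  ext p
  simp [coeffMap_apply]

lemma kernel_apply {z w : ℂ × ℂ} (hz : z ∈ bidisc) (hw : w ∈ bidisc) :
    kernel hz w = (1 - conj z.1 * w.1)⁻¹ * (1 - conj z.2 * w.2)⁻¹ := by
  have h₁ := norm_conj_mul_lt_one hz.1 hw.1
  have h₂ := norm_conj_mul_lt_one hz.2 hw.2
  have hs := (hasSum_geometric_of_norm_lt_one h₁).mul (hasSum_geometric_of_norm_lt_one h₂)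
    (summable_mul_of_summable_norm (summable_norm_geometric_of_norm_lt_one h₁)
      (summable_norm_geometric_of_norm_lt_one h₂))
  refine ((kernel hz).hasSum hw).unique (hs.congr_fun fun p => ?_)
  rw [← coeffMap_apply, coeffMap_kernel]
  simp only [map_mul, map_pow, mul_pow]
  ring

lemma kernel_apply_ne_zero {z w : ℂ × ℂ} (hz : z ∈ bidisc) (hw : w ∈ bidisc) :
    kernel hz w ≠ 0 := by
  rw [kernel_apply hz hw]
  exact mul_ne_zero (inv_ne_zero (one_sub_conj_mul_ne_zero hz.1 hw.1))
    (inv_ne_zero (one_sub_conj_mul_ne_zero hz.2 hw.2))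

lemma norm_inv_one_sub_conj_mul_le {z w : ℂ} (hz : z ∈ ball 0 1) (hw : w ∈ ball 0 1) :
    ‖(1 - conj z * w)⁻¹‖ ≤ (1 - ‖z‖)⁻¹ := by
  rw [mem_ball_zero_iff] at hz hw
  rw [norm_inv]
  refine inv_anti₀ (sub_pos.mpr hz) ?_
  calc 1 - ‖z‖ ≤ 1 - ‖z‖ * ‖w‖ := by gcongr; exact mul_le_of_le_one_right (norm_nonneg z) hw.le
    _ = ‖(1 : ℂ)‖ - ‖conj z * w‖ := by rw [norm_one, norm_mul, RCLike.norm_conj]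
    _ ≤ ‖1 - conj z * w‖ := norm_sub_norm_le _ _

lemma kernel_bounded {z : ℂ × ℂ} (hz : z ∈ bidisc) :
    ∃ C : ℝ, ∀ p ∈ bidisc, ‖kernel hz p‖ ≤ C := by
  refine ⟨(1 - ‖z.1‖)⁻¹ * (1 - ‖z.2‖)⁻¹, fun p hp => ?_⟩
  rw [kernel_apply hz hp, norm_mul]
  exact mul_le_mul (norm_inv_one_sub_conj_mul_le hz.1 hp.1)
    (norm_inv_one_sub_conj_mul_le hz.2 hp.2) (norm_nonneg _)
    (inv_nonneg.mpr (sub_nonneg.mpr (mem_ball_zero_iff.mp hz.1).le))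

lemma adjoint_mulOp_kernel {q : ℂ × ℂ → ℂ} (hq : IsMultiplier q) {z : ℂ × ℂ} (hz : z ∈ bidisc) :
    adjoint (mulOp hq) (kernel hz) = conj (q z) • kernel hz := by
  refine ext_inner_right ℂ fun f => ?_
  rw [adjoint_inner_left, inner_kernel_left, inner_smul_left, inner_kernel_left, mulOp_apply,
    RCLike.conj_conj]

end Kernel

section Inner

/-- Inner functions on the bidisc: bounded holomorphic functions whose absolute value has radial
limit one at almost every point of the torus. -/
structure IsInnerBidisc (q : ℂ × ℂ → ℂ) : Prop extends IsMultiplier q where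
  radial : ∀ᵐ x ∂torusMeasure,
    Tendsto (fun t : ℝ => ‖q (torusPoint t t x)‖) (𝓝[<] 1) (𝓝 1)

variable {q r : ℂ × ℂ → ℂ}

lemma IsInnerBidisc.mul (hq : IsInnerBidisc q) (hr : IsInnerBidisc r) :
    IsInnerBidisc fun p => q p * r p where
  differentiableOn := hq.differentiableOn.mul hr.differentiableOn
  bounded := by
    obtain ⟨C, hC⟩ := hq.bounded
    obtain ⟨D, hD⟩ := hr.bounded
    refine ⟨C * D, fun p hp => ?_⟩
    rw [norm_mul]
    exact mul_le_mul (hC p hp) (hD p hp) (norm_nonneg _) ((norm_nonneg _).trans (hC p hp))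
  radial := by
    filter_upwards [hq.radial, hr.radial] with x hqx hrx
    simpa only [norm_mul, mul_one] using hqx.mul hrx

lemma ae_torus_of_ae_circle {P : UnitAddCircle → Prop}
    (h : ∀ᵐ x ∂AddCircle.haarAddCircle, P x) (i : Fin 2) : ∀ᵐ x ∂torusMeasure, P (x i) :=
  (measurePreserving_eval (fun _ : Fin 2 => AddCircle.haarAddCircle (T := (1 : ℝ))) i
    ).quasiMeasurePreserving.ae h

lemma IsInner.isInnerBidisc_fst {θ : ℂ → ℂ} (h : IsInner θ) : IsInnerBidisc fun p => θ p.1 where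
  differentiableOn := h.differentiableOn.comp differentiableOn_fst fun _ hp => hp.1
  bounded := h.bounded.imp fun _ hC _ hp => hC _ hp.1
  radial := by
    filter_upwards [ae_torus_of_ae_circle h.radial 0] with x ⟨l, hl, hx⟩
    have hnorm := hx.norm
    rwa [hl] at hnorm

lemma IsInner.isInnerBidisc_snd {θ : ℂ → ℂ} (h : IsInner θ) : IsInnerBidisc fun p => θ p.2 where
  differentiableOn := h.differentiableOn.comp differentiableOn_snd fun _ hp => hp.2
  bounded := h.bounded.imp fun _ hC _ hp => hC _ hp.2
  radial := by
    filter_upwards [ae_torus_of_ae_circle h.radial 1] with x ⟨l, hl, hx⟩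
    have hnorm := hx.norm
    rwa [hl] at hnorm

lemma isInner_id : IsInner id where
  differentiableOn := differentiableOn_id
  bounded := ⟨1, fun z hz => (mem_ball_zero_iff.mp hz).le⟩
  radial := ae_of_all _ fun x => ⟨AddCircle.toCircle x, Circle.norm_coe _, by
    have : Continuous fun r : ℝ => (r : ℂ) * (AddCircle.toCircle x : ℂ) := by fun_prop
    simpa using (this.tendsto 1).mono_left nhdsWithin_le_nhds⟩

lemma IsInner.norm_eq_one_of_eq_mul {θ : ℂ → ℂ} (h : IsInner θ) {c : ℂ}
    (hc : ∀ z ∈ ball 0 1, θ z = c * z) : ‖c‖ = 1 := by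
  obtain ⟨x, l, hl, hx⟩ := h.radial.exists
  have hlim : Tendsto (fun r : ℝ => c * ((r : ℂ) * (AddCircle.toCircle x : ℂ))) (𝓝[<] 1)
      (𝓝 (c * ((1 : ℝ) * (AddCircle.toCircle x : ℂ)))) :=
    (Continuous.tendsto (by fun_prop) 1).mono_left nhdsWithin_le_nhds
  have hl_eq : l = c * ((1 : ℝ) * (AddCircle.toCircle x : ℂ)) := by
    refine tendsto_nhds_unique (hx.congr' ?_) hlim
    filter_upwards [eventually_mem] with r hr
    exact hc _ (norm_mul_toCircle_lt hr x)
  simpa [hl_eq, Circle.norm_coe] using hl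

end Inner

section Isometry

variable {q : ℂ × ℂ → ℂ}

lemma IsInnerBidisc.tendsto_integral_abs_norm_sq_sub_one (hq : IsInnerBidisc q) :
    Tendsto (fun t : ℝ => ∫ x, |‖q (torusPoint t t x)‖ ^ 2 - 1| ∂torusMeasure) (𝓝[<] 1)
      (𝓝 0) := by
  obtain ⟨C, hC⟩ := hq.bounded
  rw [← integral_zero (UnitAddTorus (Fin 2)) ℝ (μ := torusMeasure)]
  refine tendsto_integral_filter_of_dominated_convergence (fun _ => C ^ 2 + 1) ?_ ?_
    (integrable_const _) ?_
  · filter_upwards [eventually_mem] with t ht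
    have hcont := continuous_slice hq.differentiableOn ht ht
    exact ((hcont.norm.pow 2).sub continuous_const).abs.aestronglyMeasurable
  · filter_upwards [eventually_mem] with t ht
    refine ae_of_all _ fun x => ?_
    calc ‖|‖q (torusPoint t t x)‖ ^ 2 - 1|‖ ≤ ‖q (torusPoint t t x)‖ ^ 2 + 1 := by
          rw [norm_abs_eq_norm]
          exact (norm_sub_le _ _).trans_eq (by rw [Real.norm_of_nonneg (sq_nonneg _), norm_one])
      _ ≤ C ^ 2 + 1 := by gcongr; exact hC _ (torusPoint_mem ht ht x)
  · filter_upwards [hq.radial] with x hx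
    simpa using ((hx.pow 2).sub_const 1).abs

lemma tendsto_integral_conj_mul (f g : Hardy) :
    Tendsto (fun t : ℝ => ∫ x, conj (f (torusPoint t t x)) * g (torusPoint t t x) ∂torusMeasure)
      (𝓝[<] 1) (𝓝 ⟪f, g⟫_ℂ) := by
  rw [← inner_coeffMap]
  exact tendsto_inner f g

lemma integrable_conj_mul (f g : Hardy) {t : ℝ} (ht : t ∈ Ico (0 : ℝ) 1) :
    Integrable (fun x => conj (f (torusPoint t t x)) * g (torusPoint t t x)) torusMeasure :=
  ((Complex.continuous_conj.comp (continuous_slice f.differentiableOn ht ht)).mul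
    (continuous_slice g.differentiableOn ht ht)).integrable_of_hasCompactSupport
    (HasCompactSupport.of_compactSpace _)

lemma norm_integral_mulOp_sub_le (hq : IsMultiplier q) {f g : Hardy} {A B : ℝ}
    (hA : ∀ p ∈ bidisc, ‖f p‖ ≤ A) (hB : ∀ p ∈ bidisc, ‖g p‖ ≤ B) {t : ℝ}
    (ht : t ∈ Ico (0 : ℝ) 1) :
    ‖(∫ x, conj (mulOp hq f (torusPoint t t x)) * mulOp hq g (torusPoint t t x) ∂torusMeasure) -
        ∫ x, conj (f (torusPoint t t x)) * g (torusPoint t t x) ∂torusMeasure‖ ≤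
      (∫ x, |‖q (torusPoint t t x)‖ ^ 2 - 1| ∂torusMeasure) * (A * B) := by
  have hcont := continuous_slice hq.differentiableOn ht ht
  have hA0 : 0 ≤ A := (norm_nonneg _).trans (hA 0 zero_mem_bidisc)
  rw [← integral_sub (integrable_conj_mul _ _ ht) (integrable_conj_mul _ _ ht),
    ← integral_mul_const]
  refine norm_integral_le_of_norm_le
    ((((hcont.norm.pow 2).sub continuous_const).abs.mul
      continuous_const).integrable_of_hasCompactSupport (HasCompactSupport.of_compactSpace _))
    (ae_of_all _ fun x => ?_)
  have hx := torusPoint_mem ht ht x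
  set p := torusPoint t t x
  have hfactor : conj (mulOp hq f p) * mulOp hq g p - conj (f p) * g p =
      ((‖q p‖ ^ 2 - 1 : ℝ) : ℂ) * (conj (f p) * g p) := by
    simp only [mulOp_apply, map_mul]
    push_cast
    rw [← Complex.conj_mul']
    ring
  rw [hfactor, norm_mul, norm_mul, Complex.norm_real, Real.norm_eq_abs, RCLike.norm_conj]
  gcongr
  exacts [hA p hx, hB p hx]

lemma IsInnerBidisc.inner_mulOp_mulOp_of_bounded (hq : IsInnerBidisc q) {f g : Hardy}
    (hf : ∃ A : ℝ, ∀ p ∈ bidisc, ‖f p‖ ≤ A) (hg : ∃ B : ℝ, ∀ p ∈ bidisc, ‖g p‖ ≤ B) :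
    ⟪mulOp hq.toIsMultiplier f, mulOp hq.toIsMultiplier g⟫_ℂ = ⟪f, g⟫_ℂ := by
  obtain ⟨A, hA⟩ := hf
  obtain ⟨B, hB⟩ := hg
  have hbound : Tendsto (fun t : ℝ => (∫ x, |‖q (torusPoint t t x)‖ ^ 2 - 1| ∂torusMeasure) *
      (A * B)) (𝓝[<] 1) (𝓝 0) := by
    simpa only [zero_mul] using hq.tendsto_integral_abs_norm_sq_sub_one.mul_const (A * B)
  refine sub_eq_zero.mp (tendsto_nhds_unique
    ((tendsto_integral_conj_mul _ _).sub (tendsto_integral_conj_mul f g))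
    (squeeze_zero_norm' ?_ hbound))
  filter_upwards [eventually_mem] with t ht
  exact norm_integral_mulOp_sub_le hq.toIsMultiplier hA hB ht

lemma IsInnerBidisc.adjoint_mulOp_mulOp (hq : IsInnerBidisc q) (f : Hardy) :
    adjoint (mulOp hq.toIsMultiplier) (mulOp hq.toIsMultiplier f) = f := by
  -- Kernels are bounded and reproduce point values, so testing on them replaces density.
  have hkernel {z : ℂ × ℂ} (hz : z ∈ bidisc) : adjoint (mulOp hq.toIsMultiplier)
      (mulOp hq.toIsMultiplier (kernel hz)) = kernel hz := by
    ext w hw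
    rw [← inner_kernel_left hw, adjoint_inner_right,
      hq.inner_mulOp_mulOp_of_bounded (kernel_bounded hw) (kernel_bounded hz), inner_kernel_left]
  ext z hz
  rw [← inner_kernel_left hz, adjoint_inner_right, ← adjoint_inner_left, hkernel hz,
    inner_kernel_left]

lemma IsInnerBidisc.mulHardy_orthogonal_orthogonal (hq : IsInnerBidisc q) :
    (mulHardy q)ᗮᗮ = mulHardy q := by
  refine le_antisymm (fun f hf => ?_) (Submodule.le_orthogonal_orthogonal _)
  set V := mulOp hq.toIsMultiplier
  have hrange : V (adjoint V f) ∈ mulHardy q := ⟨adjoint V f, fun _ _ => rfl⟩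
  have hperp : f - V (adjoint V f) ∈ (mulHardy q)ᗮ := by
    rw [mem_mulHardy_orthogonal_iff hq.toIsMultiplier, map_sub, hq.adjoint_mulOp_mulOp, sub_self]
  have hzero : f - V (adjoint V f) = 0 := inner_self_eq_zero.mp
    (Submodule.inner_right_of_mem_orthogonal hperp
      (sub_mem hf (Submodule.le_orthogonal_orthogonal _ hrange)))
  rwa [sub_eq_zero.mp hzero]

end Isometry

section Coordinates

lemma isInnerBidisc_fst : IsInnerBidisc Prod.fst := isInner_id.isInnerBidisc_fst

lemma isInnerBidisc_snd : IsInnerBidisc Prod.snd := isInner_id.isInnerBidisc_snd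

lemma M₁_eq_mulOp : M₁ = mulOp isInnerBidisc_fst.toIsMultiplier := rfl

lemma M₂_eq_mulOp : M₂ = mulOp isInnerBidisc_snd.toIsMultiplier := rfl

lemma M₁_M₂_comm (f : Hardy) : M₁ (M₂ f) = M₂ (M₁ f) :=
  Hardy.ext fun _ _ => mul_left_comm _ _ _

lemma adjoint_M₁_M₁ (f : Hardy) : adjoint M₁ (M₁ f) = f := isInnerBidisc_fst.adjoint_mulOp_mulOp f

lemma adjoint_M₂_M₂ (f : Hardy) : adjoint M₂ (M₂ f) = f := isInnerBidisc_snd.adjoint_mulOp_mulOp f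

variable {q r : ℂ × ℂ → ℂ}

lemma isQuotientModule_mulHardy_orthogonal (hq : IsMultiplier q) :
    IsQuotientModule (mulHardy q)ᗮ := by
  refine ⟨Submodule.isClosed_orthogonal _, fun f hf => ?_, fun f hf => ?_⟩ <;>
  · rw [mem_mulHardy_orthogonal_iff hq] at hf ⊢
    simp only [M₁_eq_mulOp, M₂_eq_mulOp]
    rw [adjoint_mulOp_comm, hf, map_zero]

lemma Hardy.sub_apply (f g : Hardy) (p : ℂ × ℂ) : (f - g) p = f p - g p := rfl

lemma mulOp_adjoint_mulOp_apply (hr : IsMultiplier r) {p p₀ : ℂ × ℂ} (hp : p ∈ bidisc)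
    (hp₀ : p₀ ∈ bidisc)
    (hkernel : mulOp hr (adjoint (mulOp hr) (kernel hp)) = kernel hp - kernel hp₀) (f : Hardy) :
    mulOp hr (adjoint (mulOp hr) f) p = f p - f p₀ := by
  rw [← inner_kernel_left hp, ← adjoint_inner_left, adjoint_inner_right, hkernel,
    inner_sub_left, inner_kernel_left, inner_kernel_left]

lemma M₁_adjoint_M₁_apply (f : Hardy) {p : ℂ × ℂ} (hp : p ∈ bidisc) :
    M₁ (adjoint M₁ f) p = f p - f (0, p.2) := by
  refine mulOp_adjoint_mulOp_apply isInnerBidisc_fst.toIsMultiplier hp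
    (snd_axis_mem_bidisc hp.2) ?_ f
  ext w hw
  have hinv := mul_inv_cancel₀ (one_sub_conj_mul_ne_zero hp.1 hw.1)
  rw [adjoint_mulOp_kernel, mulOp_apply, Hardy.smul_apply, Hardy.sub_apply, kernel_apply hp hw,
    kernel_apply _ hw, map_zero, zero_mul, sub_zero]
  linear_combination -(1 - conj p.2 * w.2)⁻¹ * hinv

lemma M₂_adjoint_M₂_apply (f : Hardy) {p : ℂ × ℂ} (hp : p ∈ bidisc) :
    M₂ (adjoint M₂ f) p = f p - f (p.1, 0) := by
  refine mulOp_adjoint_mulOp_apply isInnerBidisc_snd.toIsMultiplier hp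
    (fst_axis_mem_bidisc hp.1) ?_ f
  ext w hw
  have hinv := mul_inv_cancel₀ (one_sub_conj_mul_ne_zero hp.2 hw.2)
  rw [adjoint_mulOp_kernel, mulOp_apply, Hardy.smul_apply, Hardy.sub_apply, kernel_apply hp hw,
    kernel_apply _ hw, map_zero, zero_mul, sub_zero]
  linear_combination -(1 - conj p.1 * w.1)⁻¹ * hinv

lemma adjoint_M₁_eq_zero_iff {f : Hardy} :
    adjoint M₁ f = 0 ↔ ∀ p ∈ bidisc, f p = f (0, p.2) := by
  refine ⟨fun h p hp => sub_eq_zero.mp ?_, fun h => ?_⟩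
  · rw [← M₁_adjoint_M₁_apply f hp, h, map_zero]
    rfl
  · have hzero : M₁ (adjoint M₁ f) = 0 :=
      Hardy.ext fun p hp => (M₁_adjoint_M₁_apply f hp).trans (sub_eq_zero.mpr (h p hp))
    rw [← adjoint_M₁_M₁ (adjoint M₁ f), hzero, map_zero]

lemma adjoint_M₂_eq_zero_iff {f : Hardy} :
    adjoint M₂ f = 0 ↔ ∀ p ∈ bidisc, f p = f (p.1, 0) := by
  refine ⟨fun h p hp => sub_eq_zero.mp ?_, fun h => ?_⟩
  · rw [← M₂_adjoint_M₂_apply f hp, h, map_zero]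
    rfl
  · have hzero : M₂ (adjoint M₂ f) = 0 :=
      Hardy.ext fun p hp => (M₂_adjoint_M₂_apply f hp).trans (sub_eq_zero.mpr (h p hp))
    rw [← adjoint_M₂_M₂ (adjoint M₂ f), hzero, map_zero]

lemma apply_eq_apply_zero_of_adjoint_eq_zero {f : Hardy} (h₁ : adjoint M₁ f = 0)
    (h₂ : adjoint M₂ f = 0) {p : ℂ × ℂ} (hp : p ∈ bidisc) : f p = f 0 :=
  (adjoint_M₁_eq_zero_iff.mp h₁ p hp).trans
    (adjoint_M₂_eq_zero_iff.mp h₂ _ (snd_axis_mem_bidisc hp.2))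

lemma mulHardy_le_mulHardy_fst (hq : ∀ w ∈ ball (0 : ℂ) 1, q (0, w) = 0) :
    mulHardy q ≤ mulHardy Prod.fst := by
  rintro f ⟨g, hg⟩
  refine ⟨adjoint M₁ f, fun p hp => ?_⟩
  rw [← M₁_apply, M₁_adjoint_M₁_apply f hp, hg (0, p.2) (snd_axis_mem_bidisc hp.2), hq _ hp.2,
    zero_mul, sub_zero]

lemma mulHardy_le_mulHardy_snd (hq : ∀ z ∈ ball (0 : ℂ) 1, q (z, 0) = 0) :
    mulHardy q ≤ mulHardy Prod.snd := by
  rintro f ⟨g, hg⟩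
  refine ⟨adjoint M₂ f, fun p hp => ?_⟩
  rw [← M₂_apply, M₂_adjoint_M₂_apply f hp, hg (p.1, 0) (fst_axis_mem_bidisc hp.1), hq _ hp.1,
    zero_mul, sub_zero]

lemma adjoint_mulOp_eq_zero_of_mulHardy_le (hq : IsMultiplier q) (hr : IsMultiplier r)
    (hle : mulHardy q ≤ mulHardy r) {f : Hardy} (hf : adjoint (mulOp hr) f = 0) :
    adjoint (mulOp hq) f = 0 :=
  (mem_mulHardy_orthogonal_iff hq).mp
    (Submodule.orthogonal_le hle ((mem_mulHardy_orthogonal_iff hr).mpr hf))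

end Coordinates

section Compression

variable {Q : Submodule ℂ Hardy} [CompleteSpace Q]

lemma coe_compression_apply (T : Hardy →L[ℂ] Hardy) (f : Q) :
    (compression Q T f : Hardy) = Q.starProjection (T f) := rfl

lemma adjoint_compression (T : Hardy →L[ℂ] Hardy) :
    adjoint (compression Q T) = compression Q (adjoint T) := by
  simp only [compression, adjoint_comp, Submodule.adjoint_subtypeL,
    Submodule.adjoint_orthogonalProjectionOnto, ContinuousLinearMap.comp_assoc]

lemma coe_adjoint_compression_apply {T : Hardy →L[ℂ] Hardy} (hT : ∀ f ∈ Q, adjoint T f ∈ Q)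
    (f : Q) : (adjoint (compression Q T) f : Hardy) = adjoint T f := by
  rw [adjoint_compression, coe_compression_apply,
    Submodule.starProjection_eq_self_iff.mpr (hT f f.2)]

lemma compression_comp_compression {S T : Hardy →L[ℂ] Hardy} (hS : ∀ f ∈ Q, adjoint S f ∈ Q) :
    compression Q S ∘L compression Q T = compression Q (S ∘L T) := by
  refine ContinuousLinearMap.ext fun f => ext_inner_left ℂ fun g => ?_
  simp only [comp_apply]
  rw [← adjoint_inner_left, Submodule.coe_inner, Submodule.coe_inner,
    coe_adjoint_compression_apply hS, coe_compression_apply, coe_compression_apply,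
    ← Submodule.inner_starProjection_left_eq_right,
    ← Submodule.inner_starProjection_left_eq_right,
    Submodule.starProjection_eq_self_iff.mpr (hS g g.2),
    Submodule.starProjection_eq_self_iff.mpr g.2, adjoint_inner_left, comp_apply]

lemma IsQuotientModule.isPhiDoublyCommuting_iff (hQ : IsQuotientModule Q) :
    IsPhiDoublyCommuting Q ↔ ∀ f ∈ Q,
      Q.starProjection (M₁ (M₂ (adjoint M₂ f))) = adjoint M₂ (Q.starProjection (M₁ (M₂ f))) := by
  have hcomp : compression Q M₁ ∘L compression Q M₂ = compression Q (M₁ ∘L M₂) :=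
    compression_comp_compression hQ.2.1
  have hleft (f : Q) : ((compression Q M₁ ∘L compression Q M₂ ∘L adjoint (compression Q M₂)) f :
      Hardy) = Q.starProjection (M₁ (M₂ (adjoint M₂ f))) := by
    rw [← ContinuousLinearMap.comp_assoc, hcomp, comp_apply, coe_compression_apply,
      coe_adjoint_compression_apply hQ.2.2, comp_apply]
  have hright (f : Q) : ((adjoint (compression Q M₂) ∘L compression Q M₁ ∘L compression Q M₂) f :
      Hardy) = adjoint M₂ (Q.starProjection (M₁ (M₂ f))) := by
    rw [hcomp, comp_apply, coe_adjoint_compression_apply hQ.2.2, coe_compression_apply, comp_apply]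
  refine ⟨fun h f hf => ?_, fun h => ⟨hQ, ContinuousLinearMap.ext fun f => Subtype.ext ?_⟩⟩
  · rw [← hleft ⟨f, hf⟩, ← hright ⟨f, hf⟩, h.comm]
  · rw [hleft, hright, h f f.2]

lemma IsPhiDoublyCommuting.M₁_M₂_mem_orthogonal (h : IsPhiDoublyCommuting Q) {f : Hardy}
    (hfQ : f ∈ Q) (hf : adjoint M₂ f = 0) : M₁ (M₂ f) ∈ Qᗮ := by
  set u := Q.starProjection (M₁ (M₂ f))
  have hker : adjoint M₂ u = 0 := by
    rw [← h.quotientModule.isPhiDoublyCommuting_iff.mp h f hfQ, hf]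
    simp only [map_zero]
  have hperp : ⟪u, M₁ (M₂ f)⟫_ℂ = 0 := by
    rw [M₁_M₂_comm, ← adjoint_inner_left, hker, inner_zero_left]
  have hnorm : ⟪u, u⟫_ℂ = 0 := by
    rw [← Submodule.inner_starProjection_left_eq_right,
      Submodule.starProjection_eq_self_iff.mpr (Submodule.starProjection_apply_mem _ _), hperp]
  exact (Submodule.starProjection_apply_eq_zero_iff Q).mp (inner_self_eq_zero.mp hnorm)

lemma IsQuotientModule.isPhiDoublyCommuting_of_forall_mem_orthogonal (hQ : IsQuotientModule Q)
    (h : ∀ f, M₁ (M₂ f) ∈ Qᗮ) : IsPhiDoublyCommuting Q :=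
  hQ.isPhiDoublyCommuting_iff.mpr fun f _ => by
    rw [(Submodule.starProjection_apply_eq_zero_iff Q).mpr (h _),
      (Submodule.starProjection_apply_eq_zero_iff Q).mpr (h _), map_zero]

end Compression

section Product

variable {θ₁ θ₂ : ℂ → ℂ}

lemma IsInner.isInnerBidisc_mul (h₁ : IsInner θ₁) (h₂ : IsInner θ₂) :
    IsInnerBidisc fun p => θ₁ p.1 * θ₂ p.2 :=
  h₁.isInnerBidisc_fst.mul h₂.isInnerBidisc_snd

lemma kernel_mem_mulHardy_orthogonal {q : ℂ × ℂ → ℂ} (hq : IsMultiplier q) {p : ℂ × ℂ}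
    (hp : p ∈ bidisc) (hqp : q p = 0) : kernel hp ∈ (mulHardy q)ᗮ := by
  rw [mem_mulHardy_orthogonal_iff hq, adjoint_mulOp_kernel, hqp, map_zero, zero_smul]

lemma adjoint_M₂_kernel_fst_axis {a : ℂ} (ha : a ∈ ball 0 1) :
    adjoint M₂ (kernel (fst_axis_mem_bidisc ha)) = 0 := by
  rw [M₂_eq_mulOp, adjoint_mulOp_kernel, map_zero, zero_smul]

lemma IsPhiDoublyCommuting.exists_mul_kernel_eq (h₁ : IsInner θ₁) (h₂ : IsInner θ₂)
    (h : IsPhiDoublyCommuting (mulHardy fun p => θ₁ p.1 * θ₂ p.2)ᗮ) {a : ℂ} (ha : a ∈ ball 0 1)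
    (hθa : θ₁ a = 0) : ∃ G : Hardy, ∀ p ∈ bidisc,
      p.1 * (p.2 * kernel (fst_axis_mem_bidisc ha) p) = θ₁ p.1 * θ₂ p.2 * G p := by
  have hq := h₁.isInnerBidisc_mul h₂
  have hmem := h.M₁_M₂_mem_orthogonal (kernel_mem_mulHardy_orthogonal hq.toIsMultiplier
    (fst_axis_mem_bidisc ha) (by rw [hθa, zero_mul])) (adjoint_M₂_kernel_fst_axis ha)
  rwa [hq.mulHardy_orthogonal_orthogonal] at hmem

lemma IsPhiDoublyCommuting.eq_zero_and_eq_zero_of_apply_eq_zero (h₁ : IsInner θ₁) (h₂ : IsInner θ₂)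
    (h : IsPhiDoublyCommuting (mulHardy fun p => θ₁ p.1 * θ₂ p.2)ᗮ) {a b : ℂ}
    (ha : a ∈ ball 0 1) (hθa : θ₁ a = 0) (hb : b ∈ ball 0 1) (hθb : θ₂ b = 0) :
    a = 0 ∧ b = 0 := by
  obtain ⟨G, hG⟩ := h.exists_mul_kernel_eq h₁ h₂ ha hθa
  have hzero {p : ℂ × ℂ} (hp : p ∈ bidisc) (hθp : θ₁ p.1 * θ₂ p.2 = 0) : p.1 = 0 ∨ p.2 = 0 := by
    have hp' := hG p hp
    rw [hθp, zero_mul] at hp'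
    simpa [kernel_apply_ne_zero _ hp] using hp'
  have hhalf : (2⁻¹ : ℂ) ∈ ball 0 1 := by norm_num
  exact ⟨(hzero (p := (a, 2⁻¹)) ⟨ha, hhalf⟩ (by rw [hθa, zero_mul])).resolve_right (by norm_num),
    (hzero (p := (2⁻¹, b)) ⟨hhalf, hb⟩ (by rw [hθb, mul_zero])).resolve_left (by norm_num)⟩

lemma IsPhiDoublyCommuting.exists_mul_eq (h₁ : IsInner θ₁) (h₂ : IsInner θ₂)
    (h : IsPhiDoublyCommuting (mulHardy fun p => θ₁ p.1 * θ₂ p.2)ᗮ)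
    (hθ₁ : θ₁ 0 = 0) (hθ₂ : θ₂ 0 = 0) :
    ∃ γ : ℂ, ∀ z ∈ ball (0 : ℂ) 1, ∀ w ∈ ball (0 : ℂ) 1, z * w = γ * (θ₁ z * θ₂ w) := by
  have hq := h₁.isInnerBidisc_mul h₂
  set k := kernel (fst_axis_mem_bidisc (mem_ball_self one_pos))
  have hk {p : ℂ × ℂ} (hp : p ∈ bidisc) : k p = 1 := by
    rw [kernel_apply _ hp]
    simp
  obtain ⟨G, hG⟩ := h.exists_mul_kernel_eq h₁ h₂ (mem_ball_self one_pos) hθ₁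
  set V := mulOp hq.toIsMultiplier
  have hVG : M₁ (M₂ k) = V G := Hardy.ext hG
  have hG₁ : adjoint M₁ G = 0 := by
    rw [← hq.adjoint_mulOp_mulOp G, ← hVG, M₁_eq_mulOp, adjoint_mulOp_comm, ← M₁_eq_mulOp,
      adjoint_M₁_M₁]
    refine adjoint_mulOp_eq_zero_of_mulHardy_le _ isInnerBidisc_fst.toIsMultiplier
      (mulHardy_le_mulHardy_fst fun w _ => by rw [hθ₁, zero_mul])
      (adjoint_M₁_eq_zero_iff.mpr fun p hp => ?_)
    rw [M₂_apply, M₂_apply, hk hp, hk (snd_axis_mem_bidisc hp.2)]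
  have hG₂ : adjoint M₂ G = 0 := by
    rw [← hq.adjoint_mulOp_mulOp G, ← hVG, M₂_eq_mulOp, adjoint_mulOp_comm, ← M₂_eq_mulOp,
      M₁_M₂_comm, adjoint_M₂_M₂]
    refine adjoint_mulOp_eq_zero_of_mulHardy_le _ isInnerBidisc_snd.toIsMultiplier
      (mulHardy_le_mulHardy_snd fun z _ => by rw [hθ₂, mul_zero])
      (adjoint_M₂_eq_zero_iff.mpr fun p hp => ?_)
    rw [M₁_apply, M₁_apply, hk hp, hk (fst_axis_mem_bidisc hp.1)]
  refine ⟨G 0, fun z hz w hw => ?_⟩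
  have hzw := hG (z, w) ⟨hz, hw⟩
  rw [hk ⟨hz, hw⟩, apply_eq_apply_zero_of_adjoint_eq_zero hG₁ hG₂ ⟨hz, hw⟩] at hzw
  linear_combination hzw

lemma IsInner.exists_norm_eq_one_and_eq_mul (h₁ : IsInner θ₁) {γ : ℂ}
    (h : ∀ z ∈ ball (0 : ℂ) 1, ∀ w ∈ ball (0 : ℂ) 1, z * w = γ * (θ₁ z * θ₂ w)) :
    ∃ c : ℂ, ‖c‖ = 1 ∧ ∀ z ∈ ball 0 1, θ₁ z = c * z := by
  have hhalf : (2⁻¹ : ℂ) ∈ ball 0 1 := by norm_num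
  have heq : (2⁻¹ : ℂ) * 2⁻¹ = γ * (θ₁ 2⁻¹ * θ₂ 2⁻¹) := h _ hhalf _ hhalf
  have hγ : γ * θ₂ 2⁻¹ ≠ 0 := fun h0 => by
    have : (2⁻¹ : ℂ) * 2⁻¹ = 0 := by linear_combination heq + θ₁ 2⁻¹ * h0
    norm_num at this
  have hmul : ∀ z ∈ ball 0 1, θ₁ z = 2 * θ₁ 2⁻¹ * z := fun z hz =>
    mul_left_cancel₀ hγ (by linear_combination 2 * z * heq - h z hz _ hhalf)
  exact ⟨_, h₁.norm_eq_one_of_eq_mul hmul, hmul⟩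

lemma isPhiDoublyCommuting_of_eq_mul {q : ℂ × ℂ → ℂ} (hq : IsMultiplier q) {c : ℂ} (hc : c ≠ 0)
    (h : ∀ p ∈ bidisc, q p = c * (p.1 * p.2)) : IsPhiDoublyCommuting (mulHardy q)ᗮ := by
  refine (isQuotientModule_mulHardy_orthogonal hq).isPhiDoublyCommuting_of_forall_mem_orthogonal
    fun f => Submodule.le_orthogonal_orthogonal _ ⟨c⁻¹ • f, fun p hp => ?_⟩
  rw [h p hp, M₁_apply, M₂_apply, Hardy.smul_apply]
  field_simp

end Product

end BidiscHardy
end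

theorem theorem3p13 (θ₁ θ₂ : ℂ → ℂ)
    (h₁ : BidiscHardy.IsInner θ₁) (h₂ : BidiscHardy.IsInner θ₂)
    (hz₁ : ∃ a ∈ Metric.ball (0 : ℂ) 1, θ₁ a = 0)
    (hz₂ : ∃ b ∈ Metric.ball (0 : ℂ) 1, θ₂ b = 0) :
    BidiscHardy.IsPhiDoublyCommuting (BidiscHardy.mulHardy fun p => θ₁ p.1 * θ₂ p.2)ᗮ ↔
      ∃ c₁ c₂ : ℂ, ‖c₁‖ = 1 ∧ ‖c₂‖ = 1 ∧
        (∀ z ∈ Metric.ball (0 : ℂ) 1, θ₁ z = c₁ * z) ∧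
        (∀ w ∈ Metric.ball (0 : ℂ) 1, θ₂ w = c₂ * w) := by
  obtain ⟨a, ha, hθa⟩ := hz₁
  obtain ⟨b, hb, hθb⟩ := hz₂
  constructor
  · intro h
    obtain ⟨rfl, rfl⟩ := h.eq_zero_and_eq_zero_of_apply_eq_zero h₁ h₂ ha hθa hb hθb
    obtain ⟨γ, hγ⟩ := h.exists_mul_eq h₁ h₂ hθa hθb
    obtain ⟨c₁, hc₁, hmul₁⟩ := h₁.exists_norm_eq_one_and_eq_mul hγ
    obtain ⟨c₂, hc₂, hmul₂⟩ := h₂.exists_norm_eq_one_and_eq_mul (θ₂ := θ₁) (γ := γ)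
      fun w hw z hz => by linear_combination hγ z hz w hw
    exact ⟨c₁, c₂, hc₁, hc₂, hmul₁, hmul₂⟩
  · rintro ⟨c₁, c₂, hc₁, hc₂, hmul₁, hmul₂⟩
    have hc : c₁ * c₂ ≠ 0 := by simp [← norm_ne_zero_iff, hc₁, hc₂]
    refine BidiscHardy.isPhiDoublyCommuting_of_eq_mul
      (h₁.isInnerBidisc_mul h₂).toIsMultiplier hc fun p hp => ?_
    rw [hmul₁ _ hp.1, hmul₂ _ hp.2]
    ring
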